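/- Let $A$ be an indeterminate, $d=-A^2-A^{-2}$, and $\Delta_n=(-1)^n\frac{A^{2n+2}-A^{-2n-2}}{A^2-A^{-2}}\in\mathbb{Q}(A)$. Evaluate a crossingless closed diagram in the annulus by $d^k\zeta^m\in\mathbb{Q}(A)[\zeta]$, where $k$ and $m$ are the numbers of its homotopically trivial and non-trivial circles, and a crossingless closed diagram in the plane by $d^{k}$, where $k$ is the number of its circles; extend both evaluations linearly over $\mathbb{Q}(A)$. Let $S_k\in\mathbb{Q}(A)[\zeta]$ be the Chebyshev polynomials of the second kind, $S_0=1$, $S_1=\zeta$, $S_{k+1}=\zeta S_k-S_{k-1}$. Let $f_n$ be the $n$-th Jones–Wenzl idempotent, that is, $f_n=\frac{1}{\prod_{m=1}^n(1+q+\cdots+q^{m-1})}\sum_{\pi\in\mathfrak{S}_n}A^{3|\pi|}b_\pi$ with $q=A^4$, $\mathfrak{S}_n$ the symmetric group, $|\pi|$ the number of inversions of $\pi$, and $b_\pi$ the minimal positive braid with permutation $\pi$, each crossing of the strands $i,i+1$ being expanded as $A\cdot\mathbb{1}+A^{-1}e_i$. For natural numbers $x,y,z\ge 0$ consider the theta graph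 with edges $a,b,c$ that consist of $y+z$, $x+z$, $x+y$ parallel strands and carry the idempotents $f_{y+z}$, $f_{x+z}$, $f_{x+y}$; at each of the two vertices $y$ strands run between $a$ and $c$, $x$ strands between $b$ and $c$, and $z$ strands between $a$ and $b$. Let $\Gamma_{\mathbb{R}^2}(x,y,z)\in\mathbb{Q}(A)$ be its evaluation in the plane. Embed it in the annulus so that the complementary region between the edges $a$ and $b$ is a disc, while the other two regions, both adjacent to the edge $c$, contain the two ends of the annulus (so that the curve formed by $c$ and $a$ goes once around the annulus), and let $\Gamma_{Ann}(x,y,z)\in\mathbb{Q}(A)[\zeta]$ be its evaluation in the annulus. Then $\Delta_{x+y}\neq0$ and $$\Gamma_{Ann}(x,y,z)=\frac{S_{x+y}(\zeta)}{\Delta_{x+y}}\,\Gamma_{\mathbb{R}^2}(x,y,z).$$ Here $S_{x+y}(\zeta)$ and $\Delta_{x+y}$ are the values of the closure of $f_{x+y}$ once around the annulus and in the plane, respectively. -/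

import Mathlib

namespace ThetaNet

open Polynomial

noncomputable section

/-! ### The coefficient field and the quantum integers -/

/-- The field `ℚ(A)` of rational functions in one variable. -/
abbrev K : Type := RatFunc ℚ

/-- The Kauffman variable. -/
def A : K := RatFunc.X

/-- The value of a homotopically trivial circle, `d = -A² - A⁻²`. -/
def d : K := -A ^ 2 - (A ^ 2)⁻¹

/-- `Δₙ = (-1)ⁿ (A^(2n+2) - A^(-2n-2)) / (A² - A⁻²)`. -/
def Delta (n : ℕ) : K :=
  (-1) ^ n * (A ^ (2 * n + 2) - (A ^ (2 * n + 2))⁻¹) / (A ^ 2 - (A ^ 2)⁻¹)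

/-- `({n}_q)! = {1}_q ⋯ {n}_q` with `{m}_q = 1 + q + ⋯ + q^(m-1)` and `q = A⁴`. -/
def quantumFactorial (n : ℕ) : K :=
  ∏ m ∈ Finset.range n, ∑ k ∈ Finset.range (m + 1), (A ^ 4) ^ k

/-! ### Crossingless diagrams -/

/-- A horizontal slice of a crossingless diagram, between a top line and a bottom line, on which
the end points are numbered `0, 1, 2, …` from left to right.
`cap i` joins the top points `i` and `i + 1` to each other;
`cup i` joins the bottom points `i` and `i + 1` to each other.
In both cases the other points are joined by vertical strands, in order. -/
inductive Slice : Type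
  | cap (i : ℕ)
  | cup (i : ℕ)

/-- The number of points on the bottom line of a slice with `m` points on its top line. -/
def Slice.below (m : ℕ) : Slice → ℕ
  | .cap _ => m - 2
  | .cup _ => m + 2

/-- The arcs of a slice. A point is a pair `(ℓ, i)` of a line `ℓ` (`0` for the top line, `1` for the
bottom line) and a position `i` on that line. -/
inductive Slice.Joins : Slice → ℕ × ℕ → ℕ × ℕ → Prop
  | cap_turn (i : ℕ) : Joins (.cap i) (0, i) (0, i + 1)
  | cap_left (i j : ℕ) (h : j < i) : Joins (.cap i) (0, j) (1, j)
  | cap_right (i j : ℕ) (h : i ≤ j) : Joins (.cap i) (0, j + 2) (1, j)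
  | cup_turn (i : ℕ) : Joins (.cup i) (1, i) (1, i + 1)
  | cup_left (i j : ℕ) (h : j < i) : Joins (.cup i) (0, j) (1, j)
  | cup_right (i j : ℕ) (h : i ≤ j) : Joins (.cup i) (0, j) (1, j + 2)

/-- The number of points on the lowest line of the diagram obtained by stacking the slices of `w`
from top to bottom, when there are `n` points on the highest line. -/
def width (n : ℕ) (w : List Slice) : ℕ := w.foldl Slice.below n

/-- The points of the stack `w` with `n` points at the top: `(t, j)` is the point in position `j`
on the line just above slice number `t` (the lowest line for `t = w.length`). -/
def Node (n : ℕ) (w : List Slice) : Type :=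
  {q : ℕ × ℕ // q.1 ≤ w.length ∧ q.2 < width n (w.take q.1)}

/-- The arcs of the closure of the stack `w`, in which each point of the lowest line is joined to
the point of the highest line in the same position, by parallel arcs going once around the annulus.
The integer records how often the arc crosses the radial cut between the lowest and the highest
line; the arc is oriented from its first point to its second. -/
inductive Arc (w : List Slice) : ℤ → ℕ × ℕ → ℕ × ℕ → Prop
  | slice (t : ℕ) (p : Slice) (s i r j : ℕ) (hp : w[t]? = some p) (h : p.Joins (s, i) (r, j)) :
      Arc w 0 (t + s, i) (t + r, j)
  | close (i : ℕ) : Arc w 1 (w.length, i) (0, i)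

/-- The circles of the closure of a stack `w` with `n` points on its highest and on its lowest line:
the connected components of the union of all arcs. -/
def Circle (n : ℕ) (w : List Slice) : Type :=
  Quot fun u v : Node n w => ∃ ε : ℤ, Arc w ε u.1 v.1

/-- The arcs of the preimage of the closed diagram in the universal cover of the annulus, whose
points are the pairs of a sheet and a point of the diagram. -/
def CoverArc (n : ℕ) (w : List Slice) (a b : ℤ × Node n w) : Prop :=
  Arc w (b.1 - a.1) a.2.1 b.2.1

/-- A circle is homotopically non-trivial in the annulus when it does not lift to a closed curve in
the universal cover: some point over it is connected to a different point of the same fibre. -/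
def Circle.Essential {n : ℕ} {w : List Slice} (C : Circle n w) : Prop :=
  ∃ u : Node n w, Quot.mk _ u = C ∧
    ∃ k : ℤ, k ≠ 0 ∧ Relation.EqvGen (CoverArc n w) (0, u) (k, u)

/-- The bracket `dᵏ zᵐ ∈ ℚ(A)[z]` of the closure in the annulus of a stack, where `k` and `m` are
the numbers of homotopically trivial and of homotopically non-trivial circles. -/
def annularBracket (n : ℕ) (w : List Slice) : K[X] :=
  C (d ^ Nat.card {c : Circle n w // ¬ c.Essential}) * X ^ Nat.card {c : Circle n w // c.Essential}

/-- The bracket of the closure in the plane, where all circles are trivial. -/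
def planarBracket (n : ℕ) (w : List Slice) : K := d ^ Nat.card (Circle n w)

/-- Formal linear combinations of stacks of slices, over `ℚ(A)`; the product is stacking, the left
factor on top. -/
abbrev Tangles : Type := MonoidAlgebra K (FreeMonoid Slice)

/-- A single stack of slices as a formal linear combination. -/
def diagram (w : List Slice) : Tangles := MonoidAlgebra.of K (FreeMonoid Slice) (FreeMonoid.ofList w)

/-- The trace in the annulus: the linear extension of the bracket of the annular closure. It is
meant for combinations of stacks with `n` points on both their highest and their lowest line. -/
def annularTrace (n : ℕ) (f : Tangles) : K[X] :=
  f.coeff.sum fun w r => r • annularBracket n w.toList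

/-- The trace in the plane: the linear extension of the bracket of the planar closure. -/
def planarTrace (n : ℕ) (f : Tangles) : K :=
  f.coeff.sum fun w r => r • planarBracket n w.toList

/-! ### The Jones-Wenzl idempotents -/

/-- The Temperley-Lieb generator that joins the top points `i, i + 1` and the bottom points
`i, i + 1`. -/
def e (i : ℕ) : Tangles := diagram [.cap i, .cup i]

/-- The Kauffman bracket expansion of the positive crossing of the strands `i` and `i + 1`. -/
def sigma (i : ℕ) : Tangles := A • (1 : Tangles) + A⁻¹ • e i

/-- The number of `i < j` whose order relative to `j` is reversed by `π⁻¹`. -/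
def lehmer {n : ℕ} (π : Equiv.Perm (Fin n)) (j : Fin n) : ℕ :=
  (Finset.univ.filter fun i : Fin n => i < j ∧ π⁻¹ j < π⁻¹ i).card

/-- A reduced word for `π` in the adjacent transpositions `(i, i + 1)`: the concatenation over
`j = 0, …, n - 1` of the words `j - 1, j - 2, …, j - lehmer π j`. -/
def permWord {n : ℕ} (π : Equiv.Perm (Fin n)) : List ℕ :=
  (List.finRange n).flatMap fun j => (List.range (lehmer π j)).map fun k => (j : ℕ) - 1 - k

/-- The bracket expansion of the minimal positive braid with permutation `π`, drawn on the
strands `s, …, s + n - 1`. -/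
def permBraid (s : ℕ) {n : ℕ} (π : Equiv.Perm (Fin n)) : Tangles :=
  ((permWord π).map fun i => sigma (s + i)).prod

/-- The Jones-Wenzl idempotent `fₙ = (1 / ({n}_{A⁴})!) ∑_π (A³)^|π| b_π`, drawn on the strands
`s, …, s + n - 1`. -/
def jonesWenzl (s n : ℕ) : Tangles :=
  (quantumFactorial n)⁻¹ •
    ∑ π : Equiv.Perm (Fin n), (A ^ 3) ^ (permWord π).length • permBraid s π

/-! ### The decorated theta curve -/

/-- `z` nested cups inserted after the first `y` strands. -/
def nestedCups (y z : ℕ) : Tangles := diagram ((List.range z).map fun k => .cup (y + k))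

/-- `z` nested caps closing off the `2 z` strands after the first `y` strands. -/
def nestedCaps (y z : ℕ) : Tangles :=
  diagram ((List.range z).reverse.map fun k => .cap (y + k))

/-- The decorated theta curve cut open along its edge `c`, with `x + y` points at the top and at the
bottom. The edges carry `a = y + z`, `b = x + z` and `c = x + y` parallel strands and the idempotents
`f_a`, `f_b` and `f_c`. At each of the two vertices `y` strands run between `c` and `a` (on the left),
`x` strands between `c` and `b` (on the right), and `z` strands between `a` and `b`. -/
def openTheta (x y z : ℕ) : Tangles :=
  jonesWenzl 0 (x + y) * nestedCups y z * (jonesWenzl 0 (y + z) * jonesWenzl (y + z) (x + z)) *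
    nestedCaps y z

/-- The evaluation of the decorated theta curve in the plane. -/
def planarTheta (x y z : ℕ) : K := planarTrace (x + y) (openTheta x y z)

/-- The evaluation of the decorated theta curve in the annulus: of the three complementary regions
of the theta curve (seen on the sphere), the one between the edges `a` and `b` is filled by a disc
and the two that are adjacent to the edge `c` contain the two ends of the annulus, so that the
closure of the edge `c` goes once around the annulus. -/
def annularTheta (x y z : ℕ) : K[X] := annularTrace (x + y) (openTheta x y z)

end

/-! ### The words for permutations are reduced words -/

theorem lehmerBlock_apply (m c v : ℕ) (hc : c ≤ m) :
    (((List.range c).map fun k => m - 1 - k).map fun i => Equiv.swap i (i + 1)).prod v =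
      if v + c = m then m else if m < v + c ∧ v ≤ m then v - 1 else v := by
  induction c generalizing v with
  | zero => simp; grind
  | succ c ih =>
    rw [List.range_succ, List.map_append, List.map_append, List.prod_append, Equiv.Perm.mul_apply]
    simp only [List.map_cons, List.map_nil, List.prod_cons, List.prod_nil, mul_one]
    rw [ih _ (by omega), Equiv.swap_apply_def]
    grind

theorem prod_permWord_aux {n : ℕ} (π : Equiv.Perm (Fin n)) (m : ℕ) (hm : m ≤ n) :
    (∀ v, m ≤ v → (((List.finRange n).take m).map fun j : Fin n =>
      (((List.range (lehmer π j)).map fun k => (j : ℕ) - 1 - k).map fun i =>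
        Equiv.swap i (i + 1)).prod).prod v = v) ∧
    ∀ i : Fin n, (i : ℕ) < m → (((List.finRange n).take m).map fun j : Fin n =>
      (((List.range (lehmer π j)).map fun k => (j : ℕ) - 1 - k).map fun i =>
        Equiv.swap i (i + 1)).prod).prod
      (Finset.univ.filter fun l : Fin n => (l : ℕ) < m ∧ π⁻¹ l < π⁻¹ i).card = i := by
  induction m with
  | zero => simp
  | succ m ih =>
    obtain ⟨ih1, ih2⟩ := ih (by omega)
    have hmn : m < n := by omega
    set M : Fin n := ⟨m, hmn⟩ with hM
    have hcard : (Finset.univ.filter fun l : Fin n => (l : ℕ) < m).card = m := by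
      have : (Finset.univ.filter fun l : Fin n => (l : ℕ) < m) = Finset.Iio M := by
        ext l; simp [hM, Fin.lt_def]
      rw [this]; simp [hM]
    have hsplit : (Finset.univ.filter fun l : Fin n => (l : ℕ) < m ∧ π⁻¹ l < π⁻¹ M).card +
        lehmer π M = m := by
      conv_rhs => rw [← hcard]
      rw [lehmer, ← Finset.card_union_of_disjoint]
      · congr 1
        ext l
        simp only [Finset.mem_union, Finset.mem_filter, Finset.mem_univ, true_and, Fin.lt_def, hM]
        constructor
        · rintro (h | h) <;> exact h.1
        · intro h
          have hne : (π⁻¹ l : Fin n) ≠ π⁻¹ M := by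
            intro h'
            have := (π⁻¹).injective h'
            rw [this] at h
            simp [hM] at h
          have hne' : ((π⁻¹ l : Fin n) : ℕ) ≠ (π⁻¹ M : Fin n) := fun h' => hne (Fin.ext h')
          simp only [hM] at hne'
          omega
      · rw [Finset.disjoint_left]
        intro l h1 h2
        simp only [Finset.mem_filter, Finset.mem_univ, true_and] at h1 h2
        exact absurd h1.2 (not_lt_of_gt h2.2)
    have htake : (List.finRange n).take (m + 1) = (List.finRange n).take m ++ [M] := by
      rw [List.take_succ_eq_append_getElem (by simpa using hmn)]
      simp [hM]
    have hstep : ∀ v, (((List.finRange n).take (m + 1)).map fun j : Fin n =>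
        (((List.range (lehmer π j)).map fun k => (j : ℕ) - 1 - k).map fun i =>
          Equiv.swap i (i + 1)).prod).prod v = (((List.finRange n).take m).map fun j : Fin n =>
        (((List.range (lehmer π j)).map fun k => (j : ℕ) - 1 - k).map fun i =>
          Equiv.swap i (i + 1)).prod).prod
        (if v + lehmer π M = m then m else if m < v + lehmer π M ∧ v ≤ m then v - 1 else v) := by
      intro v
      rw [htake, List.map_append, List.prod_append, Equiv.Perm.mul_apply]
      simp only [List.map_cons, List.map_nil, List.prod_cons, List.prod_nil, mul_one]
      rw [lehmerBlock_apply _ _ _ (show lehmer π M ≤ m by omega)]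
    constructor
    · intro v hv
      rw [hstep, if_neg (by omega), if_neg (by omega)]
      exact ih1 v (by omega)
    · intro i hi
      rw [hstep]
      by_cases him : (i : ℕ) = m
      · have hiM : i = M := Fin.ext him
        have hsame : (Finset.univ.filter fun l : Fin n => (l : ℕ) < m + 1 ∧ π⁻¹ l < π⁻¹ i) =
            Finset.univ.filter fun l : Fin n => (l : ℕ) < m ∧ π⁻¹ l < π⁻¹ M := by
          ext l
          simp only [Finset.mem_filter, Finset.mem_univ, true_and, hiM]
          constructor
          · rintro ⟨h1, h2⟩
            refine ⟨?_, h2⟩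
            rcases Nat.lt_succ_iff_lt_or_eq.1 h1 with h | h
            · exact h
            · rw [show l = M from Fin.ext h] at h2
              exact absurd h2 (lt_irrefl _)
          · rintro ⟨h1, h2⟩
            exact ⟨by omega, h2⟩
        rw [hsame, if_pos hsplit, ih1 m le_rfl, him]
      · have him' : (i : ℕ) < m := by omega
        rcases lt_or_ge (π⁻¹ M) (π⁻¹ i) with h | h
        · have hins : (Finset.univ.filter fun l : Fin n => (l : ℕ) < m + 1 ∧ π⁻¹ l < π⁻¹ i) =
              insert M (Finset.univ.filter fun l : Fin n => (l : ℕ) < m ∧ π⁻¹ l < π⁻¹ i) := by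
            ext l
            simp only [Finset.mem_filter, Finset.mem_univ, true_and, Finset.mem_insert]
            constructor
            · rintro ⟨h1, h2⟩
              rcases Nat.lt_succ_iff_lt_or_eq.1 h1 with h' | h'
              · exact Or.inr ⟨h', h2⟩
              · exact Or.inl (Fin.ext h')
            · rintro (rfl | ⟨h1, h2⟩)
              · exact ⟨by simp [hM], h⟩
              · exact ⟨by omega, h2⟩
          have hge : (Finset.univ.filter fun l : Fin n => (l : ℕ) < m ∧ π⁻¹ l < π⁻¹ M).card ≤
              (Finset.univ.filter fun l : Fin n => (l : ℕ) < m ∧ π⁻¹ l < π⁻¹ i).card := by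
            apply Finset.card_le_card
            intro l
            simp only [Finset.mem_filter, Finset.mem_univ, true_and]
            exact fun h' => ⟨h'.1, h'.2.trans h⟩
          have hle : (Finset.univ.filter fun l : Fin n => (l : ℕ) < m ∧ π⁻¹ l < π⁻¹ i).card ≤
              m - 1 := by
            have hsub : (Finset.univ.filter fun l : Fin n => (l : ℕ) < m ∧ π⁻¹ l < π⁻¹ i).card <
                (Finset.univ.filter fun l : Fin n => (l : ℕ) < m).card := by
              apply Finset.card_lt_card
              rw [Finset.ssubset_iff_of_subset (fun l => by
                simp only [Finset.mem_filter, Finset.mem_univ, true_and]; exact fun h' => h'.1)]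
              exact ⟨i, by simpa using him', by simp⟩
            omega
          rw [hins, Finset.card_insert_of_notMem (by simp [hM]), if_neg (by omega),
            if_pos (by omega), Nat.add_sub_cancel]
          exact ih2 i him'
        · have hne : (π⁻¹ i : Fin n) ≠ π⁻¹ M := by
            intro h'
            rw [(π⁻¹).injective h'] at him
            exact him rfl
          have h' : π⁻¹ i < π⁻¹ M := lt_of_le_of_ne h hne
          have hsame : (Finset.univ.filter fun l : Fin n => (l : ℕ) < m + 1 ∧ π⁻¹ l < π⁻¹ i) =
              Finset.univ.filter fun l : Fin n => (l : ℕ) < m ∧ π⁻¹ l < π⁻¹ i := by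
            ext l
            simp only [Finset.mem_filter, Finset.mem_univ, true_and]
            constructor
            · rintro ⟨h1, h2⟩
              refine ⟨?_, h2⟩
              rcases Nat.lt_succ_iff_lt_or_eq.1 h1 with h3 | h3
              · exact h3
              · rw [show l = M from Fin.ext h3] at h2
                exact absurd h2 (not_lt_of_gt h')
            · rintro ⟨h1, h2⟩
              exact ⟨by omega, h2⟩
          have hlt : (Finset.univ.filter fun l : Fin n => (l : ℕ) < m ∧ π⁻¹ l < π⁻¹ i).card <
              (Finset.univ.filter fun l : Fin n => (l : ℕ) < m ∧ π⁻¹ l < π⁻¹ M).card := by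
            apply Finset.card_lt_card
            rw [Finset.ssubset_iff_of_subset (fun l => by
              simp only [Finset.mem_filter, Finset.mem_univ, true_and]
              exact fun h3 => ⟨h3.1, h3.2.trans h'⟩)]
            refine ⟨i, ?_, by simp⟩
            simp only [Finset.mem_filter, Finset.mem_univ, true_and]
            exact ⟨him', h'⟩
          rw [hsame, if_neg (by omega), if_neg (by omega)]
          exact ih2 i him'

/-- The product of the adjacent transpositions in `permWord π` is `π`. -/
theorem prod_permWord {n : ℕ} (π : Equiv.Perm (Fin n)) (j : Fin n) :
    ((permWord π).map fun i => Equiv.swap i (i + 1)).prod (j : ℕ) = π j := by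
  have h := (prod_permWord_aux π n le_rfl).2 (π j) (π j).2
  have hc : (Finset.univ.filter fun l : Fin n => (l : ℕ) < n ∧ π⁻¹ l < π⁻¹ (π j)).card = j := by
    have : (Finset.univ.filter fun l : Fin n => (l : ℕ) < n ∧ π⁻¹ l < π⁻¹ (π j)) =
        (Finset.Iio j).map π.toEmbedding := by
      ext l
      simp [Finset.mem_map_equiv]
    rw [this, Finset.card_map, Fin.card_Iio]
  rw [hc, List.take_of_length_le (by simp)] at h
  rw [permWord, List.map_flatMap, List.flatMap_def, List.prod_flatten, List.map_map]
  exact h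

/-- The length of `permWord π` is the number of inversions of `π`. -/
theorem length_permWord {n : ℕ} (π : Equiv.Perm (Fin n)) :
    (permWord π).length =
      (Finset.univ.filter fun p : Fin n × Fin n => p.1 < p.2 ∧ π p.2 < π p.1).card := by
  have h1 : (permWord π).length = ∑ j : Fin n, lehmer π j := by
    rw [permWord, List.length_flatMap, ← List.sum_ofFn, List.ofFn_eq_map]
    simp
  have h2 : (Finset.univ.filter fun p : Fin n × Fin n => p.1 < p.2 ∧ π p.2 < π p.1).card =
      (Finset.univ.filter fun p : Fin n × Fin n => p.1 < p.2 ∧ π⁻¹ p.2 < π⁻¹ p.1).card := by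
    refine Finset.card_bij' (fun p _ => (π p.2, π p.1)) (fun p _ => (π⁻¹ p.2, π⁻¹ p.1))
      ?_ ?_ ?_ ?_ <;> simp +contextual
  rw [h1, h2, Finset.card_filter, ← Finset.univ_product_univ, Finset.sum_product_right]
  refine Finset.sum_congr rfl fun j _ => ?_
  rw [lehmer, Finset.card_filter]

end ThetaNet

namespace ThetaNet

open Polynomial

/-! ### Systems of arcs with winding numbers -/

/-! Cut the theta curve along the edge `c`: it is the closure of `f t`, where `f` is the idempotent
on `x + y` strands and `t` is everything else, a combination of crossingless diagrams with `x + y`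
end points above and below. Modulo planar isotopy and removal of circles, a crossingless diagram is
a multiple of the identity or starts with a cap, and `f` annihilates caps. So `f t = c f` for a
scalar `c` that does not depend on how the diagram is closed. The closure of `f` is `S_{x+y}(ζ)` in
the annulus and `S_{x+y}(d) = Δ_{x+y}` in the plane. Evaluating at `ζ = d` determines `c`, since
`Δ_{x+y} ≠ 0`.

Tangles are here formal combinations of words in slices, and brackets are defined by counting
components, so four things must be supplied.

Topology: the annular bracket respects the local relations (`LocalRel.annularBracket_eq`), is a
trace (`annularBracket_rotate`), and gains a factor `ζ` from an extra strand
(`annularBracket_succ`). The first two compare components of graphs whose paths carry winding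
numbers, by maps that shift sheets (`GainSystem.value_congr`).

Normal form: every stack that fits on its strands reduces to caps followed by cups
(`Valid.exists_smodEq`).

Algebra: the sum over all permutation braids factors into coset sums, and each coset sum carries a
generator `e i` to a combination of elements `e k * y` with `e k` on fewer strands. By induction the
sum kills all generators (`IsTemperleyLieb.symmetrizer_mul`), from the other side too by mirror
symmetry.

Trace: expanding the last coset sum and absorbing the shorter ones gives the Chebyshev recursion, up
to quantum factorials (`annularTraceₗ_symmetrizer`). -/

/-- A set of nodes, together with the relation `conn k a b` that `a` can be connected to `b` by a
path with winding number `k`. -/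
structure GainSystem (α : Type) where
  node : α → Prop
  conn : ℤ → α → α → Prop
  refl : ∀ a, conn 0 a a
  symm : ∀ {k a b}, conn k a b → conn (-k) b a
  trans : ∀ {k l a b c}, conn k a b → conn l b c → conn (k + l) a c

namespace GainSystem

variable {α β : Type}

/-- The relation of being connected. -/
def setoid (G : GainSystem α) : Setoid {a // G.node a} where
  r u v := ∃ k, G.conn k u.1 v.1
  iseqv := ⟨fun _ => ⟨0, G.refl _⟩, fun ⟨k, h⟩ => ⟨-k, G.symm h⟩,
    fun ⟨k, h⟩ ⟨l, h'⟩ => ⟨k + l, G.trans h h'⟩⟩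

/-- The connected components. -/
def Comp (G : GainSystem α) : Type := Quotient G.setoid

/-- A component is essential if it contains a closed path with non-zero winding number. -/
def Ess (G : GainSystem α) (c : G.Comp) : Prop :=
  ∃ u : {a // G.node a}, (Quotient.mk G.setoid u : G.Comp) = c ∧ ∃ k : ℤ, k ≠ 0 ∧ G.conn k u.1 u.1

/-- Conjugating a loop by a path does not change its winding number, so every node of a component
detects whether it is essential. -/
theorem ess_mk (G : GainSystem α) (u : {a // G.node a}) :
    G.Ess (Quotient.mk G.setoid u) ↔ ∃ k : ℤ, k ≠ 0 ∧ G.conn k u.1 u.1 := by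
  constructor
  · rintro ⟨v, hv, k, hk, h⟩
    obtain ⟨l, hl⟩ := Quotient.exact hv
    refine ⟨k, hk, ?_⟩
    have := G.trans (G.trans (G.symm hl) h) hl
    rwa [show -l + k + l = k by ring] at this
  · rintro ⟨k, hk, h⟩
    exact ⟨u, rfl, k, hk, h⟩

/-- The value `dᵏ zᵐ` of a gain system with `k` inessential and `m` essential components. -/
noncomputable def value (G : GainSystem α) : K[X] :=
  C (d ^ Nat.card {c : G.Comp // ¬ G.Ess c}) * X ^ Nat.card {c : G.Comp // G.Ess c}

theorem value_eq_of_equiv {G : GainSystem α} {H : GainSystem β} (e : G.Comp ≃ H.Comp)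
    (he : ∀ c, G.Ess c ↔ H.Ess (e c)) : G.value = H.value := by
  rw [value, value, Nat.card_congr (e.subtypeEquiv (p := G.Ess) he),
    Nat.card_congr (e.subtypeEquiv (p := fun c => ¬ G.Ess c)
      (q := fun c => ¬ H.Ess c) fun c => not_congr (he c))]

/-- The maps `f`, `f'` need to be inverse only up to connection. The potentials `g`, `g'` allow a
different choice of sheet over each node; they cancel on loops, so essential components correspond.
-/
theorem value_congr {G : GainSystem α} {H : GainSystem β} (f : α → β) (g : α → ℤ) (f' : β → α)
    (g' : β → ℤ) (hn : ∀ a, G.node a → H.node (f a)) (hn' : ∀ b, H.node b → G.node (f' b))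
    (hc : ∀ k a b, G.conn k a b → H.conn (k + g b - g a) (f a) (f b))
    (hc' : ∀ k a b, H.conn k a b → G.conn (k + g' b - g' a) (f' a) (f' b))
    (hi : ∀ a, G.node a → ∃ k, G.conn k a (f' (f a)))
    (hi' : ∀ b, H.node b → ∃ k, H.conn k b (f (f' b))) : G.value = H.value := by
  let F : G.Comp → H.Comp := Quotient.map (sa := G.setoid) (sb := H.setoid)
    (fun u => ⟨f u.1, hn _ u.2⟩) (fun u v ⟨k, h⟩ => ⟨_, hc k _ _ h⟩)
  let F' : H.Comp → G.Comp := Quotient.map (sa := H.setoid) (sb := G.setoid)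
    (fun u => ⟨f' u.1, hn' _ u.2⟩) (fun u v ⟨k, h⟩ => ⟨_, hc' k _ _ h⟩)
  have h1 : ∀ c, F' (F c) = c := by
    intro c
    induction c using Quotient.inductionOn with
    | h u => exact (Quotient.sound (s := G.setoid) (hi _ u.2)).symm
  have h2 : ∀ c, F (F' c) = c := by
    intro c
    induction c using Quotient.inductionOn with
    | h u => exact (Quotient.sound (s := H.setoid) (hi' _ u.2)).symm
  have h3 : ∀ c, G.Ess c → H.Ess (F c) := by
    intro c
    induction c using Quotient.inductionOn with
    | h u =>
      intro h
      obtain ⟨k, hk, h⟩ := (G.ess_mk u).1 h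
      refine (H.ess_mk _).2 ⟨k, hk, ?_⟩
      have := hc _ _ _ h
      rwa [add_sub_cancel_right] at this
  have h4 : ∀ c, H.Ess c → G.Ess (F' c) := by
    intro c
    induction c using Quotient.inductionOn with
    | h u =>
      intro h
      obtain ⟨k, hk, h⟩ := (H.ess_mk u).1 h
      refine (G.ess_mk _).2 ⟨k, hk, ?_⟩
      have := hc' _ _ _ h
      rwa [add_sub_cancel_right] at this
  refine value_eq_of_equiv ⟨F, F', h1, h2⟩ fun c => ⟨h3 c, fun h => ?_⟩
  have := h4 (F c) h
  rwa [h1 c] at this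

/-- If `b` is true, add an isolated inessential component, consisting of the node `none`. -/
def addPoint (G : GainSystem α) (b : Bool) : GainSystem (Option α) where
  node x := x.elim (b = true) G.node
  conn k x y := match x, y with
    | some a, some a' => G.conn k a a'
    | none, none => k = 0
    | _, _ => False
  refl x := by cases x <;> simp [G.refl]
  symm {k x y} h := by
    cases x <;> cases y <;> simp_all
    exact G.symm h
  trans {k l x y z} h h' := by
    cases x <;> cases y <;> cases z <;> simp_all
    exact G.trans h h'

theorem value_addPoint_false (G : GainSystem α) : (G.addPoint false).value = G.value := by
  -- The inverse map needs some value at `none`, which is not a node here; this is possible only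
  -- when `α` is nonempty.
  by_cases hα : Nonempty α
  · obtain ⟨a₀⟩ := hα
    refine value_congr (fun x => x.getD a₀) 0 some 0 ?_ ?_ ?_ ?_ ?_ ?_
    · rintro (_ | a) h
      · simp [addPoint] at h
      · exact h
    · exact fun a h => h
    · rintro k (_ | a) (_ | b) h
      · obtain rfl : k = 0 := h
        exact G.refl _
      · exact h.elim
      · exact h.elim
      · simpa using show G.conn k a b from h
    · intro k a b h
      simpa using show (G.addPoint false).conn k (some a) (some b) from h
    · rintro (_ | a) h
      · simp [addPoint] at h
      · exact ⟨0, G.refl _⟩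
    · exact fun a h => ⟨0, G.refl _⟩
  · have h1 : IsEmpty G.Comp := ⟨fun c => hα (c.out.1 |> fun a => ⟨a⟩)⟩
    have h2 : IsEmpty (G.addPoint false).Comp := ⟨fun c => by
      obtain ⟨_ | a, h⟩ := Quotient.out (s := (G.addPoint false).setoid) c
      · simp [addPoint] at h
      · exact hα ⟨a⟩⟩
    exact value_eq_of_equiv (Equiv.equivOfIsEmpty _ _) fun c => isEmptyElim c

/-- Loops at `none` all have winding number `0`, so the new component is inessential and contributes
one factor `d`. Finiteness matters because `Nat.card` of an infinite type is `0`. -/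
theorem value_addPoint_true (G : GainSystem α) [Finite G.Comp] :
    (G.addPoint true).value = C d * G.value := by
  let F : (G.addPoint true).Comp → Option G.Comp := Quotient.lift (s := (G.addPoint true).setoid)
    (fun u => match u with
      | ⟨none, _⟩ => none
      | ⟨some a, h⟩ => some (Quotient.mk G.setoid ⟨a, h⟩)) (by
      rintro ⟨_ | a, ha⟩ ⟨_ | b, hb⟩ ⟨k, h⟩
      · rfl
      · exact h.elim
      · exact h.elim
      · exact congrArg some (Quotient.sound (s := G.setoid) ⟨k, h⟩))
  let F' : Option G.Comp → (G.addPoint true).Comp := fun c => match c with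
    | none => Quotient.mk (G.addPoint true).setoid ⟨none, rfl⟩
    | some c => Quotient.map (sa := G.setoid) (sb := (G.addPoint true).setoid)
        (fun u => ⟨some u.1, u.2⟩) (fun u v ⟨k, h⟩ => ⟨k, h⟩) c
  have h1 : ∀ c, F' (F c) = c := by
    intro c
    induction c using Quotient.inductionOn with
    | h u => obtain ⟨_ | a, h⟩ := u <;> rfl
  have h2 : ∀ c, F (F' c) = c := by
    rintro (_ | c)
    · rfl
    · induction c using Quotient.inductionOn with
      | h u => rfl
  let e : (G.addPoint true).Comp ≃ Option G.Comp := ⟨F, F', h1, h2⟩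
  have hsome : ∀ c, (G.addPoint true).Ess (F' (some c)) ↔ G.Ess c := by
    intro c
    induction c using Quotient.inductionOn with
    | h u =>
      rw [ess_mk]
      exact (G.addPoint true).ess_mk _
  have hnone : ¬ (G.addPoint true).Ess (F' none) := by
    intro h
    obtain ⟨k, hk, h⟩ := ((G.addPoint true).ess_mk _).1 h
    exact hk h
  have e1 : {c // (G.addPoint true).Ess c} ≃ {c // G.Ess c} :=
    (e.subtypeEquiv (q := fun o => ∃ c, o = some c ∧ G.Ess c) (fun c => by
      obtain ⟨o, rfl⟩ := e.symm.surjective c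
      rw [Equiv.apply_symm_apply]
      cases o with
      | none => exact iff_of_false hnone (by simp)
      | some c => exact (hsome c).trans (by simp))).trans
    ⟨fun o => ⟨o.2.choose, o.2.choose_spec.2⟩, fun c => ⟨some c.1, c.1, rfl, c.2⟩,
      fun o => Subtype.ext o.2.choose_spec.1.symm, fun c => Subtype.ext (by
        have := (⟨c.1, rfl, c.2⟩ : ∃ c', some c.1 = some c' ∧ G.Ess c').choose_spec.1
        exact (Option.some.inj this).symm)⟩
  have e2 : {c // ¬ (G.addPoint true).Ess c} ≃ Option {c // ¬ G.Ess c} :=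
    (e.subtypeEquiv (q := fun o => ∀ c, o = some c → ¬ G.Ess c) (fun c => by
      obtain ⟨o, rfl⟩ := e.symm.surjective c
      rw [Equiv.apply_symm_apply]
      cases o with
      | none => exact iff_of_true hnone (by simp)
      | some c => exact (not_congr (hsome c)).trans (by simp))).trans
    ⟨fun o => match o with
        | ⟨none, _⟩ => none
        | ⟨some c, h⟩ => some ⟨c, h c rfl⟩,
      fun o => match o with
        | none => ⟨none, by simp⟩
        | some c => ⟨some c.1, fun c' h => by rw [← Option.some.inj h]; exact c.2⟩,
      by rintro ⟨_ | c, h⟩ <;> rfl, by rintro (_ | c) <;> rfl⟩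
  rw [value, value, Nat.card_congr e1, Nat.card_congr e2, Finite.card_option, pow_succ', C_mul,
    mul_assoc]

end GainSystem

/-! ### The gain system of a closed stack -/

theorem width_nil (n : ℕ) : width n [] = n := rfl

theorem width_cons (n : ℕ) (s : Slice) (w : List Slice) :
    width n (s :: w) = width (s.below n) w := rfl

theorem width_append (n : ℕ) (u v : List Slice) :
    width n (u ++ v) = width (width n u) v := List.foldl_append

/-- The pair `q` is a point of the stack `w`. -/
def IsNode (n : ℕ) (w : List Slice) (q : ℕ × ℕ) : Prop :=
  q.1 ≤ w.length ∧ q.2 < width n (w.take q.1)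

/-- Connectedness of points in the closure of a stack, by a path of given winding number. -/
inductive Conn (n : ℕ) (w : List Slice) : ℤ → ℕ × ℕ → ℕ × ℕ → Prop
  | arc {ε a b} : IsNode n w a → IsNode n w b → Arc w ε a b → Conn n w ε a b
  | refl (a) : Conn n w 0 a a
  | symm {k a b} : Conn n w k a b → Conn n w (-k) b a
  | trans {k l a b c} : Conn n w k a b → Conn n w l b c → Conn n w (k + l) a c

/-- The gain system of the closure of a stack. -/
def stackGain (n : ℕ) (w : List Slice) : GainSystem (ℕ × ℕ) :=
  ⟨IsNode n w, Conn n w, Conn.refl, Conn.symm, Conn.trans⟩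

/-- The shifts by `g` telescope along a path, so a map of gain systems has to be checked on single
arcs only. -/
theorem Conn.lift {β : Type} {n : ℕ} {w : List Slice} {H : GainSystem β} {f : ℕ × ℕ → β}
    {g : ℕ × ℕ → ℤ}
    (harc : ∀ ε a b, IsNode n w a → IsNode n w b → Arc w ε a b →
      H.conn (ε + g b - g a) (f a) (f b)) {k : ℤ} {a b : ℕ × ℕ} (h : Conn n w k a b) :
    H.conn (k + g b - g a) (f a) (f b) := by
  induction h with
  | arc ha hb h => exact harc _ _ _ ha hb h
  | refl a => simpa using H.refl (f a)
  | symm _ ih => convert H.symm ih using 1; ring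
  | trans _ _ ih1 ih2 => convert H.trans ih1 ih2 using 1; ring

/-- The winding number of a path is the difference between the sheets at the two ends of its lift.
-/
theorem eqvGen_coverArc_iff {n : ℕ} {w : List Slice} (a b : ℤ × Node n w) :
    Relation.EqvGen (CoverArc n w) a b ↔ Conn n w (b.1 - a.1) a.2.1 b.2.1 := by
  constructor
  · intro h
    induction h with
    | rel a b h => exact Conn.arc a.2.2 b.2.2 h
    | refl a => simpa using Conn.refl a.2.1
    | symm a b _ ih => convert ih.symm using 1; ring
    | trans a b c _ _ ih1 ih2 => convert ih1.trans ih2 using 1; ring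
  -- `Conn` is reflexive also at pairs that are not points of the stack and have no lift; hence the
  -- first alternative. The starting sheet `i` is arbitrary so that lifts can be concatenated.
  · have key : ∀ {k : ℤ} {p q : ℕ × ℕ}, Conn n w k p q →
        (p = q ∧ k = 0) ∨ ∃ (hp : IsNode n w p) (hq : IsNode n w q), ∀ i : ℤ,
          Relation.EqvGen (CoverArc n w) (i, ⟨p, hp⟩) (i + k, ⟨q, hq⟩) := by
      intro k p q h
      induction h with
      | arc ha hb h =>
        exact Or.inr ⟨ha, hb, fun i => .rel _ _ (by
          rw [CoverArc]
          rwa [show ∀ x y : ℤ, x + y - x = y by intros; ring])⟩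
      | refl a => exact Or.inl ⟨rfl, rfl⟩
      | @symm k p q _ ih =>
        obtain ⟨rfl, rfl⟩ | ⟨hp, hq, h⟩ := ih
        · exact Or.inl ⟨rfl, rfl⟩
        · refine Or.inr ⟨hq, hp, fun i => ?_⟩
          have := (h (i + -k)).symm
          rwa [neg_add_cancel_right] at this
      | @trans k l p q r _ _ ih1 ih2 =>
        obtain ⟨rfl, rfl⟩ | ⟨hp, hq, h⟩ := ih1
        · rwa [zero_add]
        · obtain ⟨rfl, rfl⟩ | ⟨hq', hr, h'⟩ := ih2
          · rw [add_zero]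
            exact Or.inr ⟨hp, hq, h⟩
          · refine Or.inr ⟨hp, hr, fun i => (h i).trans _ _ _ ?_⟩
            rw [← add_assoc]
            exact h' _
    intro h
    obtain ⟨i, p⟩ := a
    obtain ⟨j, q⟩ := b
    obtain ⟨h1, h2⟩ | ⟨hp, hq, h⟩ := key h
    · obtain rfl : p = q := Subtype.ext h1
      obtain rfl : i = j := by simp only at h2; omega
      exact .refl _
    · have := h i
      rwa [show i + (j - i) = j by ring] at this

theorem quot_mk_eq_iff {n : ℕ} {w : List Slice} (u v : Node n w) :
    (Quot.mk _ u : Circle n w) = Quot.mk _ v ↔ ∃ k, Conn n w k u.1 v.1 := by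
  constructor
  · intro h
    have h' := Quot.eqvGen_exact h
    clear h
    induction h' with
    | rel a b h => obtain ⟨ε, h⟩ := h; exact ⟨ε, .arc a.2 b.2 h⟩
    | refl a => exact ⟨0, .refl _⟩
    | symm a b _ ih => obtain ⟨k, h⟩ := ih; exact ⟨_, h.symm⟩
    | trans a b c _ _ ih1 ih2 =>
      obtain ⟨k, h⟩ := ih1
      obtain ⟨l, h'⟩ := ih2
      exact ⟨_, h.trans h'⟩
  · rintro ⟨k, h⟩
    have h : Conn n w ((k, v).1 - ((0, u) : ℤ × Node n w).1) u.1 v.1 := by simpa using h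
    have h := (eqvGen_coverArc_iff (0, u) (k, v)).2 h
    have key : ∀ a b : ℤ × Node n w, Relation.EqvGen (CoverArc n w) a b →
        (Quot.mk _ a.2 : Circle n w) = Quot.mk _ b.2 := by
      intro a b h
      induction h with
      | rel a b h => exact Quot.sound ⟨_, h⟩
      | refl a => rfl
      | symm a b _ ih => exact ih.symm
      | trans a b c _ _ ih1 ih2 => exact ih1.trans ih2
    exact key _ _ h

/-- The circles of a closed stack are the components of its gain system. -/
def circleEquiv (n : ℕ) (w : List Slice) : Circle n w ≃ (stackGain n w).Comp where
  toFun := Quot.lift (fun u => Quotient.mk (stackGain n w).setoid u) fun u v h =>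
    Quotient.sound (s := (stackGain n w).setoid) ((quot_mk_eq_iff u v).1 (Quot.sound h))
  invFun := Quotient.lift (s := (stackGain n w).setoid) (fun u => Quot.mk _ u)
    fun u v h => (quot_mk_eq_iff u v).2 h
  left_inv c := by induction c using Quot.ind; rfl
  right_inv c := by induction c using Quotient.inductionOn; rfl

theorem essential_iff {n : ℕ} {w : List Slice} (c : Circle n w) :
    c.Essential ↔ (stackGain n w).Ess (circleEquiv n w c) := by
  constructor
  · rintro ⟨u, rfl, k, hk, h⟩
    refine ⟨u, rfl, k, hk, ?_⟩
    have := (eqvGen_coverArc_iff _ _).1 h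
    rwa [sub_zero] at this
  · rintro ⟨u, hu, k, hk, h⟩
    refine ⟨u, (circleEquiv n w).injective hu, k, hk, (eqvGen_coverArc_iff _ _).2 ?_⟩
    rw [sub_zero]
    exact h

theorem annularBracket_eq_value (n : ℕ) (w : List Slice) :
    annularBracket n w = (stackGain n w).value := by
  rw [annularBracket, GainSystem.value,
    Nat.card_congr ((circleEquiv n w).subtypeEquiv (p := Circle.Essential) essential_iff),
    Nat.card_congr ((circleEquiv n w).subtypeEquiv (p := fun c => ¬ c.Essential)
      (q := fun c => ¬ (stackGain n w).Ess c) fun c => not_congr (essential_iff c))]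

instance (n : ℕ) (w : List Slice) : Finite (Node n w) := by
  have : {q : ℕ × ℕ | q.1 ≤ w.length ∧ q.2 < width n (w.take q.1)}.Finite := by
    refine ((Set.finite_Iic w.length).biUnion fun t _ =>
      (Set.finite_Iio (width n (w.take t))).image (Prod.mk t)).subset ?_
    rintro ⟨t, j⟩ ⟨h1, h2⟩
    simp only [Set.mem_iUnion]
    exact ⟨t, h1, j, h2, rfl⟩
  exact this.to_subtype

instance (n : ℕ) (w : List Slice) : Finite (Circle n w) :=
  inferInstanceAs (Finite (Quot _))

instance (n : ℕ) (w : List Slice) : Finite (stackGain n w).Comp :=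
  .of_equiv _ (circleEquiv n w)

/-- At `ζ = d` both kinds of circles count the same, and together they are all circles. -/
theorem eval_annularBracket (n : ℕ) (w : List Slice) :
    (annularBracket n w).eval d = planarBracket n w := by
  classical
  rw [annularBracket, planarBracket, eval_mul, eval_C, eval_pow, eval_X, ← pow_add, ← Nat.card_sum,
    Nat.card_congr ((Equiv.sumComm _ _).trans (Equiv.sumCompl Circle.Essential))]

/-- Each point is a circle by itself, closed by one arc of winding number `1`. -/
theorem annularBracket_nil (n : ℕ) : annularBracket n [] = X ^ n := by
  have hconn : ∀ {k a b}, Conn n [] k a b → a = b := by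
    intro k a b h
    induction h with
    | arc ha hb h =>
      cases h with
      | slice t p s i r j hp h => simp at hp
      | close i => rfl
    | refl => rfl
    | symm _ ih => exact ih.symm
    | trans _ _ ih1 ih2 => exact ih1.trans ih2
  have hess : ∀ c, (stackGain n []).Ess c := by
    intro c
    induction c using Quotient.inductionOn with
    | h u =>
      obtain ⟨⟨t, j⟩, h⟩ := u
      obtain rfl : t = 0 := by simpa using h.1
      exact ((stackGain n []).ess_mk _).2 ⟨1, one_ne_zero, Conn.arc h h (.close (w := []) j)⟩
  let e : Fin n ≃ (stackGain n []).Comp := Equiv.ofBijective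
    (fun j => Quotient.mk (stackGain n []).setoid ⟨(0, j), le_rfl, j.2⟩) (by
      constructor
      · intro i j h
        obtain ⟨k, h⟩ := Quotient.exact h
        exact Fin.ext (congrArg Prod.snd (hconn h))
      · intro c
        induction c using Quotient.inductionOn with
        | h u =>
          obtain ⟨⟨t, j⟩, h⟩ := u
          obtain rfl : t = 0 := by simpa using h.1
          exact ⟨⟨j, h.2⟩, rfl⟩)
  have h1 : Nat.card {c // (stackGain n []).Ess c} = n := by
    rw [Nat.card_congr (Equiv.subtypeUnivEquiv hess), ← Nat.card_congr e, Nat.card_fin]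
  have h2 : IsEmpty {c // ¬ (stackGain n []).Ess c} := ⟨fun c => c.2 (hess c.1)⟩
  rw [annularBracket_eq_value, GainSystem.value, h1, Nat.card_of_isEmpty]
  simp

/-! ### Replacing a part of a stack -/

/-- The arcs of a stack of slices that is not closed. -/
inductive OpenArc (p : List Slice) : ℕ × ℕ → ℕ × ℕ → Prop
  | mk (t : ℕ) (sl : Slice) (s i r j : ℕ) (hp : p[t]? = some sl) (h : sl.Joins (s, i) (r, j)) :
      OpenArc p (t + s, i) (t + r, j)

/-- Connectedness of points of a stack of slices that is not closed. -/
def OpenConn (m : ℕ) (p : List Slice) : ℕ × ℕ → ℕ × ℕ → Prop :=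
  Relation.EqvGen fun a b => IsNode m p a ∧ IsNode m p b ∧ OpenArc p a b

/-- The point `x.2` of the highest line (if `x.1 = 0`) or of the lowest line of a stack of length
`l`. -/
def endPoint (l : ℕ) (x : ℕ × ℕ) : ℕ × ℕ := (if x.1 = 0 then 0 else l, x.2)

/-- The point `q` of a stack that is placed below `a` slices. -/
def lower (a : ℕ) (q : ℕ × ℕ) : ℕ × ℕ := (a + q.1, q.2)

/-- The map `c` labels the points of the stack `p` with end points such that each point is connected
to its label, and labels are constant along arcs. The points without a label form a single closed
component through `star` when `b` is true, and there are none otherwise. The end points have the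
labels prescribed by `β`. -/
structure IsLabelling (m m' : ℕ) (p : List Slice) (β : ℕ × ℕ → ℕ × ℕ) (b : Bool) (star : ℕ × ℕ)
    (c : ℕ × ℕ → Option (ℕ × ℕ)) : Prop where
  width_eq : width m p = m'
  arc : ∀ x y, IsNode m p x → IsNode m p y → OpenArc p x y → c x = c y
  label : ∀ x y, IsNode m p x → c x = some y →
    IsNode m p (endPoint p.length y) ∧ OpenConn m p x (endPoint p.length y)
  closed : ∀ x, IsNode m p x → c x = none → b = true ∧ OpenConn m p x star
  star_mem : b = true → IsNode m p star ∧ c star = none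
  top : ∀ j < m, c (0, j) = some (β (0, j))
  bot : ∀ j < m', c (p.length, j) = some (β (1, j))

theorem Slice.Joins.le_one {sl : Slice} {a b : ℕ × ℕ} (h : sl.Joins a b) : a.1 ≤ 1 ∧ b.1 ≤ 1 := by
  cases h <;> simp

theorem IsLabelling.eq_of_conn {m m' : ℕ} {p : List Slice} {β : ℕ × ℕ → ℕ × ℕ} {b : Bool}
    {star : ℕ × ℕ} {c : ℕ × ℕ → Option (ℕ × ℕ)} (hc : IsLabelling m m' p β b star c) {x y : ℕ × ℕ}
    (h : OpenConn m p x y) : c x = c y := by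
  induction h with
  | rel x y h => exact hc.arc _ _ h.1 h.2.1 h.2.2
  | refl => rfl
  | symm _ _ _ ih => exact ih.symm
  | trans _ _ _ _ _ ih1 ih2 => exact ih1.trans ih2

/-! ### Transport of points between a stack and its modification -/

section Context

variable {n : ℕ} {u p p' v : List Slice}

theorem isNode_lower_iff {q : ℕ × ℕ} (hq : q.1 ≤ p.length) :
    IsNode n (u ++ p ++ v) (lower u.length q) ↔ IsNode (width n u) p q := by
  have h : (u ++ p ++ v).take (u.length + q.1) = u ++ p.take q.1 := by
    rw [List.append_assoc, List.take_length_add_append, List.take_append_of_le_length hq]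
  simp only [IsNode, lower, h, width_append, List.length_append]
  exact and_congr_left fun _ => ⟨fun _ => hq, fun _ => by omega⟩

theorem isNode_append_left_iff {q : ℕ × ℕ} (hq : q.1 ≤ u.length) :
    IsNode n (u ++ v) q ↔ q.2 < width n (u.take q.1) := by
  simp only [IsNode, List.take_append_of_le_length hq, List.length_append]
  exact and_iff_right (by omega)

theorem isNode_append_right_iff {q : ℕ × ℕ} :
    IsNode n (u ++ v) (lower u.length q) ↔ IsNode (width n u) v q := by
  simp only [IsNode, lower, List.take_length_add_append, width_append, List.length_append]
  exact and_congr_left fun _ => by omega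

/-- Only closing arcs cross the cut, so a path inside `p` has winding number `0`. -/
theorem OpenConn.conn {x y : ℕ × ℕ} (h : OpenConn (width n u) p x y) :
    Conn n (u ++ p ++ v) 0 (lower u.length x) (lower u.length y) := by
  induction h with
  | rel x y h =>
    obtain ⟨hx, hy, h⟩ := h
    refine .arc ((isNode_lower_iff hx.1).2 hx) ((isNode_lower_iff hy.1).2 hy) ?_
    cases h with
    | mk t sl s i r j hp h =>
      have ht : t < p.length := (List.getElem?_eq_some_iff.1 hp).1
      have := Arc.slice (w := u ++ p ++ v) (u.length + t) sl s i r j (by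
        rw [List.append_assoc, List.getElem?_append_right (by omega), Nat.add_sub_cancel_left,
          List.getElem?_append_left ht, hp]) h
      simpa [lower, add_assoc] using this
  | refl x => exact .refl _
  | symm x y _ ih => simpa using ih.symm
  | trans x y z _ _ ih1 ih2 => simpa using ih1.trans ih2

/-- Move a point of `u ++ p ++ v` to a point of `u ++ p' ++ v`, where `u`, `p`, `p'` have lengths
`a`, `l`, `l'` and `c` labels the points of `p` with end points. -/
def transport (a l l' : ℕ) (c : ℕ × ℕ → Option (ℕ × ℕ)) (q : ℕ × ℕ) : Option (ℕ × ℕ) :=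
  if q.1 < a then some q else if a + l < q.1 then some (q.1 - l + l', q.2)
  else (c (q.1 - a, q.2)).map fun x => lower a (endPoint l' x)

theorem transport_lower {a l l' : ℕ} {c : ℕ × ℕ → Option (ℕ × ℕ)} {q : ℕ × ℕ} (hq : q.1 ≤ l) :
    transport a l l' c (lower a q) = (c q).map fun x => lower a (endPoint l' x) := by
  rw [transport, if_neg (by simp [lower]), if_neg (by simp [lower]; omega)]
  simp [lower]

variable {m' : ℕ} {β : ℕ × ℕ → ℕ × ℕ} {b b' : Bool} {star star' : ℕ × ℕ}
  {c c' : ℕ × ℕ → Option (ℕ × ℕ)}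

/-- A point on the line where `p` begins is moved to the end point `β (0, j)`, perhaps a different
one. The stack `p'` gives it the same label, so the two are connected inside `p'`. `transport_below`
is the same at the other boundary line. -/
theorem transport_above (hc : IsLabelling (width n u) m' p β b star c)
    (hc' : IsLabelling (width n u) m' p' β b' star' c') {q : ℕ × ℕ}
    (hn : IsNode n (u ++ p ++ v) q) (hq : q.1 ≤ u.length) :
    ∃ y, transport u.length p.length p'.length c q = some y ∧ Conn n (u ++ p' ++ v) 0 y q := by
  obtain hq | hq := hq.lt_or_eq
  · exact ⟨q, by rw [transport, if_pos hq], .refl _⟩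
  · obtain ⟨t, j⟩ := q
    obtain rfl : t = u.length := hq
    have hj : IsNode (width n u) p (0, j) := (isNode_lower_iff (Nat.zero_le _)).1 hn
    have hj' : IsNode (width n u) p' (0, j) := ⟨Nat.zero_le _, hj.2⟩
    have := transport_lower (a := u.length) (l' := p'.length) (c := c) hj.1
    rw [hc.top j hj.2] at this
    refine ⟨_, this, ?_⟩
    have h := (hc'.label _ _ hj' (hc'.top j hj.2)).2
    simpa [lower] using (h.conn (v := v)).symm

theorem transport_below (hc : IsLabelling (width n u) m' p β b star c)
    (hc' : IsLabelling (width n u) m' p' β b' star' c') {q : ℕ × ℕ}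
    (hn : IsNode n (u ++ p ++ v) q) (hq : u.length + p.length ≤ q.1) :
    ∃ y, transport u.length p.length p'.length c q = some y ∧
      Conn n (u ++ p' ++ v) 0 y (q.1 - p.length + p'.length, q.2) := by
  obtain hq | hq := hq.lt_or_eq
  · exact ⟨_, by rw [transport, if_neg (by omega), if_pos hq], .refl _⟩
  · obtain ⟨t, j⟩ := q
    obtain rfl : u.length + p.length = t := hq
    have hj : IsNode (width n u) p (p.length, j) := (isNode_lower_iff le_rfl).1 hn
    have hjm : j < m' := by
      have := hj.2
      rwa [List.take_length, hc.width_eq] at this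
    have hj' : IsNode (width n u) p' (p'.length, j) :=
      ⟨le_rfl, by rwa [List.take_length, hc'.width_eq]⟩
    have := transport_lower (a := u.length) (l' := p'.length) (c := c) hj.1
    rw [hc.bot j hjm] at this
    refine ⟨_, this, ?_⟩
    have h := (hc'.label _ _ hj' (hc'.bot j hjm)).2
    have h := (h.conn (v := v)).symm
    simp only [neg_zero] at h
    convert h using 1
    ext <;> simp [lower]

theorem isNode_below (hc : IsLabelling (width n u) m' p β b star c)
    (hc' : IsLabelling (width n u) m' p' β b' star' c') {q : ℕ × ℕ}
    (hn : IsNode n (u ++ p ++ v) q) (hq : u.length + p.length ≤ q.1) :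
    IsNode n (u ++ p' ++ v) (q.1 - p.length + p'.length, q.2) := by
  have h1 : q = lower (u ++ p).length (q.1 - (u.length + p.length), q.2) := by
    simp only [lower, List.length_append]
    ext <;> simp; omega
  have h2 : (q.1 - p.length + p'.length, q.2) =
      lower (u ++ p').length (q.1 - (u.length + p.length), q.2) := by
    simp only [lower, List.length_append]
    ext <;> simp; omega
  rw [h1, isNode_append_right_iff, width_append, hc.width_eq] at hn
  rwa [h2, isNode_append_right_iff, width_append, hc'.width_eq]

theorem isNode_above {q : ℕ × ℕ} (hn : IsNode n (u ++ p ++ v) q) (hq : q.1 ≤ u.length) :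
    IsNode n (u ++ p' ++ v) q := by
  rw [List.append_assoc, isNode_append_left_iff hq] at hn ⊢
  exact hn

theorem node_cases {q : ℕ × ℕ} :
    q.1 ≤ u.length ∨ u.length + p.length ≤ q.1 ∨ ∃ x, x.1 ≤ p.length ∧ q = lower u.length x := by
  by_cases h1 : q.1 ≤ u.length
  · exact Or.inl h1
  by_cases h2 : u.length + p.length ≤ q.1
  · exact Or.inr (Or.inl h2)
  · refine Or.inr (Or.inr ⟨(q.1 - u.length, q.2), by simp only; omega, ?_⟩)
    ext <;> simp [lower]; omega

theorem transport_isNode (hc : IsLabelling (width n u) m' p β b star c)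
    (hc' : IsLabelling (width n u) m' p' β b' star' c') {q y : ℕ × ℕ}
    (hn : IsNode n (u ++ p ++ v) q) (hy : transport u.length p.length p'.length c q = some y) :
    IsNode n (u ++ p' ++ v) y := by
  rw [transport] at hy
  split_ifs at hy with h1 h2
  · obtain rfl := Option.some.inj hy
    exact isNode_above hn h1.le
  · obtain rfl := Option.some.inj hy
    exact isNode_below hc hc' hn h2.le
  · obtain ⟨z, hz, rfl⟩ := Option.map_eq_some_iff.1 hy
    have hq : q = lower u.length (q.1 - u.length, q.2) := by
      ext <;> simp [lower]; omega
    rw [hq, isNode_lower_iff (by simp only; omega)] at hn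
    have h := (hc.label _ _ hn hz).1
    by_cases h0 : z.1 = 0
    · refine (isNode_lower_iff ?_).2 ⟨?_, ?_⟩ <;> simp only [endPoint, h0, if_true, Nat.zero_le]
      have := h.2
      simpa [endPoint, h0] using this
    · refine (isNode_lower_iff ?_).2 ⟨?_, ?_⟩ <;> simp only [endPoint, h0, if_false, le_refl]
      have := h.2
      simp only [endPoint, h0, if_false, List.take_length, hc.width_eq] at this
      rwa [List.take_length, hc'.width_eq]

/-- Labels are constant along the arcs of `p`, so these collapse; all other arcs survive, up to
paths inside `p'` at their ends. -/
theorem transport_arc (hc : IsLabelling (width n u) m' p β b star c)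
    (hc' : IsLabelling (width n u) m' p' β b' star' c') {ε : ℤ} {x y : ℕ × ℕ}
    (hx : IsNode n (u ++ p ++ v) x) (hy : IsNode n (u ++ p ++ v) y)
    (h : Arc (u ++ p ++ v) ε x y) :
    (ε = 0 ∧ transport u.length p.length p'.length c x =
      transport u.length p.length p'.length c y) ∨
    ∃ x' y', transport u.length p.length p'.length c x = some x' ∧
      transport u.length p.length p'.length c y = some y' ∧ Conn n (u ++ p' ++ v) ε x' y' := by
  cases h with
  | slice t sl s i r j hp h =>
    have h1 := h.le_one
    obtain ⟨hs, hr⟩ : s ≤ 1 ∧ r ≤ 1 := h1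
    by_cases htu : t < u.length
    · obtain ⟨x', hx', hcx⟩ := transport_above hc hc' hx (by simp only; omega)
      obtain ⟨y', hy', hcy⟩ := transport_above hc hc' hy (by simp only; omega)
      refine Or.inr ⟨x', y', hx', hy', ?_⟩
      have := (hcx.trans (.arc (isNode_above hx (by simp only; omega))
        (isNode_above hy (by simp only; omega)) (.slice t sl s i r j ?_ h))).trans hcy.symm
      · simpa using this
      · rw [List.append_assoc, List.getElem?_append_left htu] at hp ⊢
        exact hp
    · by_cases htp : t < u.length + p.length
      · refine Or.inl ⟨rfl, ?_⟩
        have hp' : p[t - u.length]? = some sl := by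
          rwa [List.getElem?_append_left (by simpa using htp),
            List.getElem?_append_right (by omega)] at hp
        have e1 : ((t + s, i) : ℕ × ℕ) = lower u.length (t - u.length + s, i) := by
          ext <;> simp [lower]; omega
        have e2 : ((t + r, j) : ℕ × ℕ) = lower u.length (t - u.length + r, j) := by
          ext <;> simp [lower]; omega
        rw [e1, isNode_lower_iff (by simp only; omega)] at hx
        rw [e2, isNode_lower_iff (by simp only; omega)] at hy
        rw [e1, e2, transport_lower (by simp only; omega), transport_lower (by simp only; omega),
          hc.arc _ _ hx hy (.mk _ _ _ _ _ _ hp' h)]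
      · obtain ⟨x', hx', hcx⟩ := transport_below hc hc' hx (by simp only; omega)
        obtain ⟨y', hy', hcy⟩ := transport_below hc hc' hy (by simp only; omega)
        refine Or.inr ⟨x', y', hx', hy', ?_⟩
        have ha := Arc.slice (w := u ++ p' ++ v) (t - p.length + p'.length) sl s i r j (by
          rw [List.getElem?_append_right (by simp; omega)] at hp ⊢
          rw [← hp]
          congr 1
          simp only [List.length_append]
          omega) h
        have e1 : t - p.length + p'.length + s = t + s - p.length + p'.length := by omega
        have e2 : t - p.length + p'.length + r = t + r - p.length + p'.length := by omega
        rw [e1, e2] at ha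
        have := (hcx.trans (.arc (isNode_below hc hc' hx (by simp only; omega))
          (isNode_below hc hc' hy (by simp only; omega)) ha)).trans hcy.symm
        simpa using this
  | close i =>
    obtain ⟨x', hx', hcx⟩ := transport_below hc hc' hx (by simp)
    obtain ⟨y', hy', hcy⟩ := transport_above hc hc' hy (by simp)
    refine Or.inr ⟨x', y', hx', hy', ?_⟩
    have ha := Arc.close (w := u ++ p' ++ v) i
    have e1 : (u ++ p' ++ v).length = (u ++ p ++ v).length - p.length + p'.length := by
      simp only [List.length_append]
      omega
    rw [e1] at ha
    have := (hcx.trans (.arc (isNode_below hc hc' hx (by simp))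
      (isNode_above hy (by simp)) ha)).trans hcy.symm
    simpa using this

theorem transport_conn (hc : IsLabelling (width n u) m' p β b star c)
    (hc' : IsLabelling (width n u) m' p' β b' star' c') {k : ℤ} {x y : ℕ × ℕ}
    (h : Conn n (u ++ p ++ v) k x y) :
    ((stackGain n (u ++ p' ++ v)).addPoint b).conn k
      (transport u.length p.length p'.length c x) (transport u.length p.length p'.length c y) := by
  have := h.lift (H := (stackGain n (u ++ p' ++ v)).addPoint b) (g := 0)
    (f := transport u.length p.length p'.length c) ?_
  · simpa using this
  · intro ε x y hx hy h
    obtain ⟨rfl, h'⟩ | ⟨x', y', hx', hy', h'⟩ := transport_arc hc hc' hx hy h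
    · rw [h']
      simpa using GainSystem.refl _ _
    · rw [hx', hy', Pi.zero_apply, Pi.zero_apply, add_zero, sub_zero]
      exact h'

/-- On and outside the boundary lines of `p`, both transports move a point only along paths. A point
inside `p` has the same image as the end point that labels it, and is connected to that end point.
-/
theorem transport_transport (hc : IsLabelling (width n u) m' p β b star c)
    (hc' : IsLabelling (width n u) m' p' β b' star' c') {q y : ℕ × ℕ}
    (hn : IsNode n (u ++ p ++ v) q) (hy : transport u.length p.length p'.length c q = some y) :
    ∃ z, transport u.length p'.length p.length c' y = some z ∧ Conn n (u ++ p ++ v) 0 q z := by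
  have above : ∀ q y, IsNode n (u ++ p ++ v) q → q.1 ≤ u.length →
      transport u.length p.length p'.length c q = some y →
      ∃ z, transport u.length p'.length p.length c' y = some z ∧ Conn n (u ++ p ++ v) 0 q z := by
    intro q y hn hq hy
    obtain ⟨y', hy', h⟩ := transport_above hc hc' hn hq
    obtain rfl : y = y' := Option.some.inj (hy.symm.trans hy')
    obtain ⟨z', hz', h'⟩ := transport_above (v := v) hc' hc (isNode_above hn hq) hq
    have h := transport_conn hc' hc h
    rw [hz'] at h
    rcases hz : transport u.length p'.length p.length c' y with _ | z
    · rw [hz] at h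
      exact h.elim
    · rw [hz] at h
      exact ⟨z, rfl, by simpa using (h'.symm.trans (Conn.symm h))⟩
  have below : ∀ q y, IsNode n (u ++ p ++ v) q → u.length + p.length ≤ q.1 →
      transport u.length p.length p'.length c q = some y →
      ∃ z, transport u.length p'.length p.length c' y = some z ∧ Conn n (u ++ p ++ v) 0 q z := by
    intro q y hn hq hy
    obtain ⟨y', hy', h⟩ := transport_below hc hc' hn hq
    obtain rfl : y = y' := Option.some.inj (hy.symm.trans hy')
    obtain ⟨z', hz', h'⟩ := transport_below (v := v) hc' hc (isNode_below hc hc' hn hq)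
      (by simp only; omega)
    rw [show ((q.1 - p.length + p'.length - p'.length + p.length, q.2) : ℕ × ℕ) = q by
      ext <;> simp; omega] at h'
    have h := transport_conn hc' hc h
    rw [hz'] at h
    rcases hz : transport u.length p'.length p.length c' y with _ | z
    · rw [hz] at h
      exact h.elim
    · rw [hz] at h
      exact ⟨z, rfl, by simpa using (h'.symm.trans (Conn.symm h))⟩
  obtain hq | hq | ⟨x, hx, rfl⟩ := node_cases (u := u) (p := p) (q := q)
  · exact above q y hn hq hy
  · exact below q y hn hq hy
  · rw [transport_lower hx] at hy
    obtain ⟨a, ha, rfl⟩ := Option.map_eq_some_iff.1 hy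
    rw [isNode_lower_iff hx] at hn
    obtain ⟨h1, h2⟩ := hc.label _ _ hn ha
    have h2 := h2.conn (v := v)
    have h3 : transport u.length p.length p'.length c (lower u.length (endPoint p.length a)) =
        some (lower u.length (endPoint p'.length a)) := by
      rw [transport_lower h1.1, ← hc.eq_of_conn (hc.label _ _ hn ha).2, ha]
      rfl
    have hout : (lower u.length (endPoint p.length a)).1 ≤ u.length ∨
        u.length + p.length ≤ (lower u.length (endPoint p.length a)).1 := by
      simp only [lower, endPoint]
      split_ifs <;> simp
    obtain ⟨z, hz, h⟩ := hout.elim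
      (fun hout => above _ _ ((isNode_lower_iff h1.1).2 h1) hout h3)
      (fun hout => below _ _ ((isNode_lower_iff h1.1).2 h1) hout h3)
    exact ⟨z, hz, by simpa using h2.trans h⟩

/-- A part of a stack can be replaced by any stack with the same connections between the end points,
up to a factor `d` for an additional closed component. -/
theorem annularBracket_replace (hc : IsLabelling (width n u) m' p β b star c)
    (hc' : IsLabelling (width n u) m' p' β false star' c') :
    annularBracket n (u ++ p ++ v) = C (if b then d else 1) * annularBracket n (u ++ p' ++ v) := by
  have hval : (stackGain n (u ++ p ++ v)).value =
      ((stackGain n (u ++ p' ++ v)).addPoint b).value := by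
    -- The labelling of `p'` has flag `false`, so no point of `p'` lacks a label.
    have hsome : ∀ y, IsNode n (u ++ p' ++ v) y →
        ∃ z, transport u.length p'.length p.length c' y = some z := by
      intro y hy
      rw [← Option.isSome_iff_exists, Option.isSome_iff_ne_none]
      intro h
      have hy' := hy
      rw [transport] at h
      split_ifs at h with h1 h2
      have hq : y = lower u.length (y.1 - u.length, y.2) := by
        ext <;> simp [lower]; omega
      rw [hq, isNode_lower_iff (by simp only; omega)] at hy
      have := (hc'.closed _ hy (by simpa using h)).1
      simp at this
    -- The extra node `none` stands for the closed component of `p`; the way back sends it to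
    -- `star`.
    refine GainSystem.value_congr (transport u.length p.length p'.length c) 0
      (fun y => (y.bind fun y => transport u.length p'.length p.length c' y).getD
        (lower u.length star)) 0 ?_ ?_ ?_ ?_ ?_ ?_
    · intro q hq
      rcases hy : transport u.length p.length p'.length c q with _ | y
      · rw [transport] at hy
        split_ifs at hy with h1 h2
        have e : q = lower u.length (q.1 - u.length, q.2) := by
          ext <;> simp [lower]; omega
        have hq : IsNode _ _ _ := hq
        rw [e, isNode_lower_iff (by simp only; omega)] at hq
        exact (hc.closed _ hq (by simpa using hy)).1
      · exact transport_isNode hc hc' hq hy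
    · rintro (_ | y) hy
      · have := (hc.star_mem hy).1
        exact (isNode_lower_iff this.1).2 this
      · obtain ⟨z, hz⟩ := hsome y hy
        have := transport_isNode hc' hc hy hz
        simpa [hz] using show (stackGain n (u ++ p ++ v)).node z from this
    · intro k x y h
      simpa using transport_conn hc hc' h
    · rintro k (_ | x) (_ | y) h
      · obtain rfl : k = 0 := h
        exact Conn.refl _
      · exact h.elim
      · exact h.elim
      · have h : Conn n (u ++ p' ++ v) k x y := h
        have h := transport_conn hc' hc h
        rcases hx : transport u.length p'.length p.length c' x with _ | x' <;>
          rcases hy : transport u.length p'.length p.length c' y with _ | y' <;>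
          rw [hx, hy] at h
        · obtain rfl : k = 0 := h
          simpa [hx, hy] using GainSystem.refl _ _
        · exact h.elim
        · exact h.elim
        · simpa [hx, hy] using (show (stackGain n (u ++ p ++ v)).conn k x' y' from h)
    · intro q hq
      rcases hy : transport u.length p.length p'.length c q with _ | y
      · rw [transport] at hy
        split_ifs at hy with h1 h2
        have e : q = lower u.length (q.1 - u.length, q.2) := by
          ext <;> simp [lower]; omega
        have hq : IsNode _ _ _ := hq
        rw [e, isNode_lower_iff (by simp only; omega)] at hq
        have := (hc.closed _ hq (by simpa using hy)).2.conn (v := v)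
        rw [← e] at this
        exact ⟨0, this⟩
      · obtain ⟨z, hz, h⟩ := transport_transport hc hc' hq hy
        exact ⟨0, by simpa [hz] using show (stackGain n (u ++ p ++ v)).conn 0 q z from h⟩
    · rintro (_ | y) hy
      · obtain ⟨h1, h2⟩ := hc.star_mem hy
        refine ⟨0, ?_⟩
        simp only [Option.bind_none, Option.getD_none, transport_lower h1.1, h2]
        exact GainSystem.refl _ _
      · obtain ⟨z, hz⟩ := hsome y hy
        obtain ⟨y', hy', h⟩ := transport_transport hc' hc hy hz
        refine ⟨0, ?_⟩
        simp only [Option.bind_some, hz, Option.getD_some, hy']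
        exact h
  rw [annularBracket_eq_value, annularBracket_eq_value, hval]
  cases b
  · simp [GainSystem.value_addPoint_false]
  · simp [GainSystem.value_addPoint_true]

end Context

/-! ### The local relations -/

/-- The position of strand number `k` after two further strands have been inserted at `i`. -/
def insertTwo (i k : ℕ) : ℕ := if k < i then k else k + 2

/-- The values `q` on the top line and `r` on the bottom line are equal along the arcs of a slice
with `m` points on its top line. -/
def Slice.Eqs {Q : Type} (m : ℕ) (q r : ℕ → Q) : Slice → Prop
  | .cap i => q i = q (i + 1) ∧ ∀ k, k + 2 < m → r k = q (insertTwo i k)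
  | .cup i => r i = r (i + 1) ∧ ∀ k < m, q k = r (insertTwo i k)

/-- A slice with `m` points on its top line fits if its cap joins two of them, or its cup is inserted
between them. -/
def Slice.Fits (m : ℕ) : Slice → Prop
  | .cap i => i + 2 ≤ m
  | .cup i => i ≤ m

/-- `Slice.Eqs` turns the arcs of a slice into equations suited to automation; this lemma and
`Slice.eqs_of_joins` translate in the two directions. -/
theorem Slice.Joins.eq_of_eqs {Q : Type} {m : ℕ} {q : ℕ → ℕ → Q} {sl : Slice} (hf : sl.Fits m)
    (h : sl.Eqs m (q 0) (q 1)) {s a r b : ℕ} (hJ : sl.Joins (s, a) (r, b))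
    (hi : s = 0 → a < m) : q s a = q r b := by
  cases hJ with
  | cap_turn => exact h.1
  | cap_left i _ hj =>
    simp only [Slice.Fits] at hf
    have := h.2 a (by omega)
    rw [insertTwo, if_pos hj] at this
    exact this.symm
  | cap_right i _ hj =>
    have := h.2 b (hi rfl)
    rw [insertTwo, if_neg (by omega)] at this
    exact this.symm
  | cup_turn => exact h.1
  | cup_left i _ hj =>
    have := h.2 a (hi rfl)
    rwa [insertTwo, if_pos hj] at this
  | cup_right i _ hj =>
    have := h.2 a (hi rfl)
    rwa [insertTwo, if_neg (by omega)] at this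

theorem Slice.eqs_of_joins {Q : Type} {m : ℕ} {q : ℕ → ℕ → Q} {sl : Slice} (hf : sl.Fits m)
    (h : ∀ s i r j, sl.Joins (s, i) (r, j) → (s = 0 → i < m) → (r = 0 → j < m) →
      (s = 1 → i < sl.below m) → (r = 1 → j < sl.below m) → q s i = q r j) :
    sl.Eqs m (q 0) (q 1) := by
  cases sl with
  | cap i =>
    simp only [Slice.Fits, Slice.below] at hf h
    refine ⟨h _ _ _ _ (.cap_turn i) ?_ ?_ ?_ ?_, fun k hk => (Eq.symm ?_)⟩
    on_goal 5 =>
      rw [insertTwo]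
      split_ifs with hk'
      · refine h _ _ _ _ (.cap_left i k hk') ?_ ?_ ?_ ?_ <;> omega
      · refine h _ _ _ _ (.cap_right i k (by omega)) ?_ ?_ ?_ ?_ <;> omega
    all_goals omega
  | cup i =>
    simp only [Slice.Fits, Slice.below] at hf h
    refine ⟨h _ _ _ _ (.cup_turn i) ?_ ?_ ?_ ?_, fun k hk => ?_⟩
    on_goal 5 =>
      rw [insertTwo]
      split_ifs with hk'
      · refine h _ _ _ _ (.cup_left i k hk') ?_ ?_ ?_ ?_ <;> omega
      · refine h _ _ _ _ (.cup_right i k (by omega)) ?_ ?_ ?_ ?_ <;> omega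
    all_goals omega

/-- The label `top j` for the points `(0, j)` and `bot j` for the others. -/
def endLabel (top bot : ℕ → ℕ × ℕ) (x : ℕ × ℕ) : ℕ × ℕ := if x.1 = 0 then top x.2 else bot x.2

/-- The labelling of a stack of two slices with given values on its three lines. -/
def lineLabel (top bot : ℕ → ℕ × ℕ) (mid : ℕ → Option (ℕ × ℕ)) (x : ℕ × ℕ) : Option (ℕ × ℕ) :=
  if x.1 = 0 then some (top x.2) else if x.1 = 1 then mid x.2 else some (bot x.2)

/-- The conditions for `lineLabel top bot mid` to be a labelling of the stack `[s, t]`. -/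
structure IsLineLabelling (m m₁ m' : ℕ) (s t : Slice) (top bot : ℕ → ℕ × ℕ)
    (mid : ℕ → Option (ℕ × ℕ)) (b : Bool) (star : ℕ) : Prop where
  below_fst : s.below m = m₁
  below_snd : t.below m₁ = m'
  fits_fst : s.Fits m
  fits_snd : t.Fits m₁
  eqs_fst : s.Eqs m (fun j => some (top j)) mid
  eqs_snd : t.Eqs m₁ mid (fun j => some (bot j))
  top_lt : ∀ j < m, (top j).1 = 0 ∧ (top j).2 < m ∨ (top j).1 = 1 ∧ (top j).2 < m'
  bot_lt : ∀ j < m', (bot j).1 = 0 ∧ (bot j).2 < m ∨ (bot j).1 = 1 ∧ (bot j).2 < m'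
  mid_lt : ∀ j < m₁, ∀ y, mid j = some y → y.1 = 0 ∧ y.2 < m ∨ y.1 = 1 ∧ y.2 < m'
  closed : ∀ j < m₁, mid j = none → b = true
  star_lt : b = true → star < m₁ ∧ mid star = none
  conn : ∀ (Q : Type) (q : ℕ → ℕ → Q), s.Eqs m (q 0) (q 1) → t.Eqs m₁ (q 1) (q 2) →
    (∀ j < m, q 0 j = q (if (top j).1 = 0 then 0 else 2) (top j).2) ∧
    (∀ j < m', q 2 j = q (if (bot j).1 = 0 then 0 else 2) (bot j).2) ∧
    ∀ j < m₁, (∀ y, mid j = some y → q 1 j = q (if y.1 = 0 then 0 else 2) y.2) ∧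
      (mid j = none → q 1 j = q 1 star)

/-- The field `conn` concerns all functions that are constant along arcs. Applied to the quotient
map of the points by the arcs, its equalities become actual paths. -/
theorem IsLineLabelling.isLabelling {m m₁ m' : ℕ} {s t : Slice} {top bot : ℕ → ℕ × ℕ}
    {mid : ℕ → Option (ℕ × ℕ)} {b : Bool} {star : ℕ}
    (h : IsLineLabelling m m₁ m' s t top bot mid b star) :
    IsLabelling m m' [s, t] (endLabel top bot) b (1, star) (lineLabel top bot mid) := by
  obtain ⟨hm₁, hm', hs, ht, h1, h2, htop, hbot, hmid, hnone, hstar, hq⟩ := h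
  subst hm₁ hm'
  have hnode0 : ∀ j, IsNode m [s, t] (0, j) ↔ j < m := fun j => by simp [IsNode, width]
  have hnode1 : ∀ j, IsNode m [s, t] (1, j) ↔ j < s.below m := fun j => by simp [IsNode, width]
  have hnode2 : ∀ j, IsNode m [s, t] (2, j) ↔ j < t.below (s.below m) := fun j => by
    simp [IsNode, width]
  have hend : ∀ y : ℕ × ℕ, (y.1 = 0 ∧ y.2 < m ∨ y.1 = 1 ∧ y.2 < t.below (s.below m)) →
      IsNode m [s, t] (endPoint 2 y) := by
    rintro ⟨e, j⟩ (⟨rfl, h⟩ | ⟨rfl, h⟩)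
    · exact (hnode0 j).2 h
    · exact (hnode2 j).2 h
  let r : ℕ × ℕ → ℕ × ℕ → Prop := fun a b => IsNode m [s, t] a ∧ IsNode m [s, t] b ∧
    OpenArc [s, t] a b
  have hQ := hq (Quot r) (fun i j => Quot.mk r (i, j))
    (Slice.eqs_of_joins (q := fun i j => Quot.mk r (i, j)) hs fun e i e' j hJ a1 a2 a3 a4 => by
      refine Quot.sound ⟨?_, ?_, ?_⟩
      · have := hJ.le_one.1
        obtain rfl | rfl : e = 0 ∨ e = 1 := by simp only at this; omega
        · exact (hnode0 _).2 (a1 rfl)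
        · exact (hnode1 _).2 (a3 rfl)
      · have := hJ.le_one.2
        obtain rfl | rfl : e' = 0 ∨ e' = 1 := by simp only at this; omega
        · exact (hnode0 _).2 (a2 rfl)
        · exact (hnode1 _).2 (a4 rfl)
      · simpa using OpenArc.mk (p := [s, t]) 0 s e i e' j rfl hJ)
    (Slice.eqs_of_joins (q := fun i j => Quot.mk r (1 + i, j)) ht fun e i e' j hJ a1 a2 a3 a4 => by
      refine Quot.sound ⟨?_, ?_, ?_⟩
      · have := hJ.le_one.1
        obtain rfl | rfl : e = 0 ∨ e = 1 := by simp only at this; omega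
        · exact (hnode1 _).2 (a1 rfl)
        · exact (hnode2 _).2 (a3 rfl)
      · have := hJ.le_one.2
        obtain rfl | rfl : e' = 0 ∨ e' = 1 := by simp only at this; omega
        · exact (hnode1 _).2 (a2 rfl)
        · exact (hnode2 _).2 (a4 rfl)
      · exact OpenArc.mk (p := [s, t]) 1 t e i e' j rfl hJ)
  obtain ⟨q0, q2, q1⟩ := hQ
  have hconn : ∀ {x y}, Quot.mk r x = Quot.mk r y → OpenConn m [s, t] x y :=
    fun h => Quot.eqvGen_exact h
  refine ⟨rfl, ?_, ?_, ?_, ?_, fun j _ => rfl, fun j _ => rfl⟩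
  · intro x y hx hy h
    cases h with
    | mk k sl e i e' j hp hJ =>
      have hk : k < 2 := (List.getElem?_eq_some_iff.1 hp).1
      interval_cases k
      · obtain rfl : s = sl := by simpa using hp
        rw [zero_add] at hx
        refine Slice.Joins.eq_of_eqs (m := m) (q := fun i j => lineLabel top bot mid (0 + i, j)) hs ?_ hJ
          fun he => ?_
        · exact h1
        · rw [he] at hx
          exact (hnode0 _).1 hx
      · obtain rfl : t = sl := by simpa using hp
        refine Slice.Joins.eq_of_eqs (m := s.below m) (q := fun i j => lineLabel top bot mid (1 + i, j)) ht ?_ hJ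
          fun he => ?_
        · exact h2
        · rw [he] at hx
          exact (hnode1 _).1 hx
  · rintro ⟨e, j⟩ y hx hy
    have he : e ≤ 2 := hx.1
    interval_cases e
    · obtain rfl : top j = y := by simpa [lineLabel] using hy
      exact ⟨hend _ (htop j ((hnode0 j).1 hx)), hconn (q0 j ((hnode0 j).1 hx))⟩
    · have hy : mid j = some y := by simpa [lineLabel] using hy
      exact ⟨hend _ (hmid j ((hnode1 j).1 hx) y hy), hconn ((q1 j ((hnode1 j).1 hx)).1 y hy)⟩
    · obtain rfl : bot j = y := by simpa [lineLabel] using hy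
      exact ⟨hend _ (hbot j ((hnode2 j).1 hx)), hconn (q2 j ((hnode2 j).1 hx))⟩
  · rintro ⟨e, j⟩ hx hy
    have he : e ≤ 2 := hx.1
    interval_cases e
    · simp [lineLabel] at hy
    · have hy : mid j = none := by simpa [lineLabel] using hy
      exact ⟨hnone j ((hnode1 j).1 hx) hy, hconn ((q1 j ((hnode1 j).1 hx)).2 hy)⟩
    · simp [lineLabel] at hy
  · intro hb
    exact ⟨(hnode1 _).2 (hstar hb).1, (hstar hb).2⟩

/-- The two lines of an empty stack coincide; their common points are named after the highest line.
-/
theorem isLabelling_nil (m : ℕ) : IsLabelling m m [] (endLabel (Prod.mk 0) (Prod.mk 0))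
    false (1, 0) (fun x => some (0, x.2)) where
  width_eq := rfl
  arc := by
    intro x y _ _ h
    cases h with
    | mk t sl s i r j hp h => simp at hp
  label := by
    rintro ⟨t, j⟩ y h hy
    obtain rfl := Option.some.inj hy
    obtain rfl : t = 0 := by simpa using h.1
    exact ⟨h, .refl _⟩
  closed := by simp
  star_mem := by simp
  top := by simp [endLabel]
  bot := by simp [endLabel]

section LocalRelations

variable {n m i j : ℕ} {u v : List Slice}

/-- The two middle points `i`, `i + 1` form the circle and stay unlabelled; every other strand runs
straight through. -/
theorem isLineLabelling_circle (hi : i ≤ m) :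
    IsLineLabelling m (m + 2) m (.cup i) (.cap i)
      (Prod.mk 0)
      (Prod.mk 0)
      (fun k => if k < i then some (0, k) else if k < i + 2 then none else some (0, k - 2)) true i := by
  constructor
  case conn =>
    simp only [Slice.Eqs, insertTwo]
    intro Q q h1 h2
    refine ⟨fun k hk => ?_, fun k hk => ?_, fun k hk => ⟨?_, ?_⟩⟩
    all_goals grind
  all_goals try simp only [Slice.Fits, Slice.below, Slice.Eqs, insertTwo]
  all_goals grind

/-- The middle points `i`, `i + 1`, `i + 2` all lie on the zigzag, which is strand `i` after
straightening. -/
theorem isLineLabelling_cup_cap_succ (hi : i < m) :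
    IsLineLabelling m (m + 2) m (.cup i) (.cap (i + 1))
      (Prod.mk 0)
      (Prod.mk 0)
      (fun k => some (if k ≤ i then (0, k) else if k = i + 1 then (0, i) else (0, k - 2))) false 0 := by
  constructor
  case conn =>
    simp only [Slice.Eqs, insertTwo]
    intro Q q h1 h2
    refine ⟨fun k hk => ?_, fun k hk => ?_, fun k hk => ⟨?_, ?_⟩⟩
    all_goals grind
  all_goals try simp only [Slice.Fits, Slice.below, Slice.Eqs, insertTwo]
  all_goals grind

theorem isLineLabelling_cup_succ_cap (hi : i < m) :
    IsLineLabelling m (m + 2) m (.cup (i + 1)) (.cap i)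
      (Prod.mk 0)
      (Prod.mk 0)
      (fun k => some (if k ≤ i then (0, k) else if k = i + 1 then (0, i) else (0, k - 2))) false 0 := by
  constructor
  case conn =>
    simp only [Slice.Eqs, insertTwo]
    intro Q q h1 h2
    refine ⟨fun k hk => ?_, fun k hk => ?_, fun k hk => ⟨?_, ?_⟩⟩
    all_goals grind
  all_goals try simp only [Slice.Fits, Slice.below, Slice.Eqs, insertTwo]
  all_goals grind

/-- One end is chosen to represent each arc. What matters is that `top` and `bot` agree literally
with those of `isLineLabelling_cap_cup_of_le`, since a replacement compares stacks with the same end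
labels. The later labellings come in such pairs too. -/
theorem isLineLabelling_cup_cap_left (hij : i ≤ j) (hj : j + 2 ≤ m) :
    IsLineLabelling m (m + 2) m (.cup (j + 2)) (.cap i)
      (fun k => if k = i + 1 then (0, i) else (0, k))
      (fun k => if k < i then (0, k) else if k < j then (0, k + 2) else
      if k < j + 2 then (1, j) else (0, k))
      (fun k => some (if k = i + 1 then (0, i) else if k < j + 2 then (0, k) else
      if k < j + 4 then (1, j) else (0, k - 2))) false 0 := by
  constructor
  case conn =>
    simp only [Slice.Eqs, insertTwo]
    intro Q q h1 h2
    refine ⟨fun k hk => ?_, fun k hk => ?_, fun k hk => ⟨?_, ?_⟩⟩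
    all_goals grind
  all_goals try simp only [Slice.Fits, Slice.below, Slice.Eqs, insertTwo]
  all_goals grind

theorem isLineLabelling_cap_cup_of_le (hij : i ≤ j) (hj : j + 2 ≤ m) :
    IsLineLabelling m (m - 2) m (.cap i) (.cup j)
      (fun k => if k = i + 1 then (0, i) else (0, k))
      (fun k => if k < i then (0, k) else if k < j then (0, k + 2) else
      if k < j + 2 then (1, j) else (0, k))
      (fun k => some (if k < i then (0, k) else (0, k + 2))) false 0 := by
  constructor
  case conn =>
    simp only [Slice.Eqs, insertTwo]
    intro Q q h1 h2
    refine ⟨fun k hk => ?_, fun k hk => ?_, fun k hk => ⟨?_, ?_⟩⟩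
    -- A bottom point `k` outside the cup comes from the middle point `k` or `k - 2`; these are the
    -- instances needed.
    on_goal 2 =>
      have := h1.2 k
      have := h2.2 k
      have := h1.2 (k - 2)
      have := h2.2 (k - 2)
    all_goals grind
  all_goals try simp only [Slice.Fits, Slice.below, Slice.Eqs, insertTwo]
  all_goals grind

theorem isLineLabelling_cup_cap_right (hij : j ≤ i) (hi : i + 2 ≤ m) :
    IsLineLabelling m (m + 2) m (.cup j) (.cap (i + 2))
      (fun k => if k = i + 1 then (0, i) else (0, k))
      (fun k => if k < j then (0, k) else if k < j + 2 then (1, j) else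
      if k < i + 2 then (0, k - 2) else (0, k))
      (fun k => some (if k < j then (0, k) else if k < j + 2 then (1, j) else
      if k = i + 3 then (0, i) else (0, k - 2))) false 0 := by
  constructor
  case conn =>
    simp only [Slice.Eqs, insertTwo]
    intro Q q h1 h2
    refine ⟨fun k hk => ?_, fun k hk => ?_, fun k hk => ⟨?_, ?_⟩⟩
    all_goals grind
  all_goals try simp only [Slice.Fits, Slice.below, Slice.Eqs, insertTwo]
  all_goals grind

theorem isLineLabelling_cap_cup_of_ge (hij : j ≤ i) (hi : i + 2 ≤ m) :
    IsLineLabelling m (m - 2) m (.cap i) (.cup j)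
      (fun k => if k = i + 1 then (0, i) else (0, k))
      (fun k => if k < j then (0, k) else if k < j + 2 then (1, j) else
      if k < i + 2 then (0, k - 2) else (0, k))
      (fun k => some (if k < i then (0, k) else (0, k + 2))) false 0 := by
  constructor
  case conn =>
    simp only [Slice.Eqs, insertTwo]
    intro Q q h1 h2
    refine ⟨fun k hk => ?_, fun k hk => ?_, fun k hk => ⟨?_, ?_⟩⟩
    on_goal 2 =>
      have := h1.2 k
      have := h2.2 k
      have := h1.2 (k - 2)
      have := h2.2 (k - 2)
    all_goals grind
  all_goals try simp only [Slice.Fits, Slice.below, Slice.Eqs, insertTwo]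
  all_goals grind

theorem isLineLabelling_cap_cap_right (hij : i ≤ j) (hj : j + 4 ≤ m) :
    IsLineLabelling m (m - 2) (m - 4) (.cap (j + 2)) (.cap i)
      (fun k => if k = i + 1 then (0, i) else if k = j + 3 then (0, j + 2) else (0, k))
      (fun k => if k < i then (0, k) else if k < j then (0, k + 2) else (0, k + 4))
      (fun k => some (if k = i + 1 then (0, i) else if k < j + 2 then (0, k) else (0, k + 2))) false 0 := by
  constructor
  case conn =>
    simp only [Slice.Eqs, insertTwo]
    intro Q q h1 h2
    refine ⟨fun k hk => ?_, fun k hk => ?_, fun k hk => ⟨?_, ?_⟩⟩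
    all_goals grind
  all_goals try simp only [Slice.Fits, Slice.below, Slice.Eqs, insertTwo]
  all_goals grind

theorem isLineLabelling_cap_cap_left (hij : i ≤ j) (hj : j + 4 ≤ m) :
    IsLineLabelling m (m - 2) (m - 4) (.cap i) (.cap j)
      (fun k => if k = i + 1 then (0, i) else if k = j + 3 then (0, j + 2) else (0, k))
      (fun k => if k < i then (0, k) else if k < j then (0, k + 2) else (0, k + 4))
      (fun k => some (if k < i then (0, k) else if k = j + 1 then (0, j + 2) else (0, k + 2))) false 0 := by
  constructor
  case conn =>
    simp only [Slice.Eqs, insertTwo]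
    intro Q q h1 h2
    refine ⟨fun k hk => ?_, fun k hk => ?_, fun k hk => ⟨?_, ?_⟩⟩
    all_goals grind
  all_goals try simp only [Slice.Fits, Slice.below, Slice.Eqs, insertTwo]
  all_goals grind

theorem isLineLabelling_cup_cup_right (hij : i ≤ j) (hj : j ≤ m) :
    IsLineLabelling m (m + 2) (m + 4) (.cup j) (.cup i)
      (Prod.mk 0)
      (fun k => if k < i then (0, k) else if k < i + 2 then (1, i) else if k < j + 2 then (0, k - 2)
      else if k < j + 4 then (1, j + 2) else (0, k - 4))
      (fun k => some (if k < j then (0, k) else if k < j + 2 then (1, j + 2) else (0, k - 2))) false 0 := by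
  constructor
  case conn =>
    simp only [Slice.Eqs, insertTwo]
    intro Q q h1 h2
    refine ⟨fun k hk => ?_, fun k hk => ?_, fun k hk => ⟨?_, ?_⟩⟩
    all_goals grind
  all_goals try simp only [Slice.Fits, Slice.below, Slice.Eqs, insertTwo]
  all_goals grind

theorem isLineLabelling_cup_cup_left (hij : i ≤ j) (hj : j ≤ m) :
    IsLineLabelling m (m + 2) (m + 4) (.cup i) (.cup (j + 2))
      (Prod.mk 0)
      (fun k => if k < i then (0, k) else if k < i + 2 then (1, i) else if k < j + 2 then (0, k - 2)
      else if k < j + 4 then (1, j + 2) else (0, k - 4))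
      (fun k => some (if k < i then (0, k) else if k < i + 2 then (1, i) else (0, k - 2))) false 0 := by
  constructor
  case conn =>
    simp only [Slice.Eqs, insertTwo]
    intro Q q h1 h2
    refine ⟨fun k hk => ?_, fun k hk => ?_, fun k hk => ⟨?_, ?_⟩⟩
    all_goals grind
  all_goals try simp only [Slice.Fits, Slice.below, Slice.Eqs, insertTwo]
  all_goals grind

/-- The local relation `p = r • q` between stacks `p`, `q` of slices with `m` points at the top. -/
inductive LocalRel (m : ℕ) : List Slice → K → List Slice → Prop
  | circle (i : ℕ) (h : i ≤ m) : LocalRel m [.cup i, .cap i] d []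
  | cup_cap_succ (i : ℕ) (h : i < m) : LocalRel m [.cup i, .cap (i + 1)] 1 []
  | cup_succ_cap (i : ℕ) (h : i < m) : LocalRel m [.cup (i + 1), .cap i] 1 []
  | cup_cap_left (i j : ℕ) (h : i ≤ j) (hj : j + 2 ≤ m) :
      LocalRel m [.cup (j + 2), .cap i] 1 [.cap i, .cup j]
  | cup_cap_right (i j : ℕ) (h : j ≤ i) (hi : i + 2 ≤ m) :
      LocalRel m [.cup j, .cap (i + 2)] 1 [.cap i, .cup j]
  | cap_cap (i j : ℕ) (h : i ≤ j) (hj : j + 4 ≤ m) :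
      LocalRel m [.cap (j + 2), .cap i] 1 [.cap i, .cap j]
  | cup_cup (i j : ℕ) (h : i ≤ j) (hj : j ≤ m) :
      LocalRel m [.cup j, .cup i] 1 [.cup i, .cup (j + 2)]

theorem IsLineLabelling.annularBracket_eq {m₁ m₁' m' : ℕ} {s t s' t' : Slice}
    {top bot : ℕ → ℕ × ℕ} {mid mid' : ℕ → Option (ℕ × ℕ)}
    (h : IsLineLabelling (width n u) m₁ m' s t top bot mid false 0)
    (h' : IsLineLabelling (width n u) m₁' m' s' t' top bot mid' false 0) :
    annularBracket n (u ++ [s, t] ++ v) = C 1 * annularBracket n (u ++ [s', t'] ++ v) := by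
  rw [annularBracket_replace h.isLabelling h'.isLabelling]
  simp

/-- The bracket of the annular closure satisfies the local relations. -/
theorem LocalRel.annularBracket_eq {p q : List Slice} {r : K} (h : LocalRel (width n u) p r q) :
    annularBracket n (u ++ p ++ v) = C r * annularBracket n (u ++ q ++ v) := by
  cases h with
  | circle i h =>
    have := annularBracket_replace (v := v) (isLineLabelling_circle h).isLabelling
      (isLabelling_nil _)
    rwa [if_pos rfl] at this
  | cup_cap_succ i h =>
    have := annularBracket_replace (v := v) (isLineLabelling_cup_cap_succ h).isLabelling
      (isLabelling_nil _)
    rwa [if_neg Bool.false_ne_true] at this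
  | cup_succ_cap i h =>
    have := annularBracket_replace (v := v) (isLineLabelling_cup_succ_cap h).isLabelling
      (isLabelling_nil _)
    rwa [if_neg Bool.false_ne_true] at this
  | cup_cap_left i j h hj =>
    exact (isLineLabelling_cup_cap_left h hj).annularBracket_eq (isLineLabelling_cap_cup_of_le h hj)
  | cup_cap_right i j h hi =>
    exact (isLineLabelling_cup_cap_right h hi).annularBracket_eq
      (isLineLabelling_cap_cup_of_ge h hi)
  | cap_cap i j h hj =>
    exact (isLineLabelling_cap_cap_right h hj).annularBracket_eq (isLineLabelling_cap_cap_left h hj)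
  | cup_cup i j h hj =>
    exact (isLineLabelling_cup_cup_right h hj).annularBracket_eq (isLineLabelling_cup_cup_left h hj)

end LocalRelations

/-! ### Rotation of a closed stack -/

section Rotation

variable {n : ℕ} {u v : List Slice}

/-- The point of `v ++ u` corresponding to a point of `u ++ v`, where `u`, `v` have lengths `a`,
`b`. -/
def rotate (a b : ℕ) (q : ℕ × ℕ) : ℕ × ℕ := if q.1 < a then (b + q.1, q.2) else (q.1 - a, q.2)

/-- The shift of sheets that accompanies `rotate`. -/
def rotateShift (a : ℕ) (q : ℕ × ℕ) : ℤ := if q.1 < a then 0 else 1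

/-- The line between `u` and `v` becomes two lines after rotation: the first and the last. `rotate`
chooses the first one, and the closing arc joins it to the last one; this accounts for the shift by
`1`. -/
theorem rotate_above (hw : width n (u ++ v) = n) {q : ℕ × ℕ} (hn : IsNode n (u ++ v) q)
    (hq : q.1 ≤ u.length) :
    IsNode (width n u) (v ++ u) (lower v.length q) ∧
    Conn (width n u) (v ++ u) (rotateShift u.length q) (lower v.length q)
      (rotate u.length v.length q) := by
  rw [width_append] at hw
  have h1 : IsNode (width n u) (v ++ u) (lower v.length q) := by
    rw [isNode_append_right_iff, hw]
    exact ⟨hq, (isNode_append_left_iff hq).1 hn⟩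
  refine ⟨h1, ?_⟩
  obtain hq | hq := hq.lt_or_eq
  · rw [rotateShift, rotate, if_pos hq, if_pos hq]
    exact .refl _
  · rw [rotateShift, rotate, if_neg (by omega), if_neg (by omega)]
    have e1 : lower v.length q = ((v ++ u).length, q.2) := by
      simp [lower, hq]
    have e2 : q.1 - u.length = 0 := by omega
    rw [e1] at h1 ⊢
    rw [e2]
    refine .arc h1 ⟨Nat.zero_le _, ?_⟩ (.close _)
    have := h1.2
    rwa [List.take_length, width_append, hw] at this

theorem rotate_below {q : ℕ × ℕ} (hn : IsNode n (u ++ v) q) (hq : u.length ≤ q.1) :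
    IsNode (width n u) (v ++ u) (rotate u.length v.length q) := by
  rw [rotate, if_neg (by omega)]
  have h1 : q = lower u.length (q.1 - u.length, q.2) := by
    ext <;> simp [lower]; omega
  rw [h1, isNode_append_right_iff] at hn
  exact (isNode_append_left_iff hn.1).2 hn.2

theorem rotate_arc (hw : width n (u ++ v) = n) {ε : ℤ} {x y : ℕ × ℕ} (hx : IsNode n (u ++ v) x)
    (hy : IsNode n (u ++ v) y) (h : Arc (u ++ v) ε x y) :
    Conn (width n u) (v ++ u) (ε + rotateShift u.length y - rotateShift u.length x)
      (rotate u.length v.length x) (rotate u.length v.length y) := by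
  cases h with
  | slice t sl s i r j hp h =>
    have h1 := h.le_one
    obtain ⟨hs, hr⟩ : s ≤ 1 ∧ r ≤ 1 := h1
    by_cases ht : t < u.length
    · obtain ⟨hx1, hx2⟩ := rotate_above hw hx (by simp only; omega)
      obtain ⟨hy1, hy2⟩ := rotate_above hw hy (by simp only; omega)
      have ha := Arc.slice (w := v ++ u) (v.length + t) sl s i r j (by
        rw [List.getElem?_append_left ht] at hp
        rw [List.getElem?_append_right (by omega), Nat.add_sub_cancel_left, hp]) h
      rw [add_assoc, add_assoc] at ha
      convert (hx2.symm.trans (.arc hx1 hy1 ha)).trans hy2 using 1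
      ring
    · have hx1 := rotate_below hx (by simp only; omega)
      have hy1 := rotate_below hy (by simp only; omega)
      have htv : t - u.length < v.length := by
        have := (List.getElem?_eq_some_iff.1 hp).1
        simp only [List.length_append] at this
        omega
      have ha := Arc.slice (w := v ++ u) (t - u.length) sl s i r j (by
        rw [List.getElem?_append_right (by omega)] at hp
        rw [List.getElem?_append_left htv, hp]) h
      rw [rotate, if_neg (by simp only; omega)] at hx1 hy1 ⊢
      rw [rotate, if_neg (by simp only; omega), rotateShift, rotateShift,
        if_neg (by simp only; omega), if_neg (by simp only; omega), zero_add, sub_self]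
      refine .arc hx1 hy1 ?_
      have e1 : t + s - u.length = t - u.length + s := by omega
      have e2 : t + r - u.length = t - u.length + r := by omega
      simp only [e1, e2]
      exact ha
  | close i =>
    obtain ⟨hy1, hy2⟩ := rotate_above hw hy (by simp)
    have e : rotate u.length v.length ((u ++ v).length, i) = lower v.length (0, i) := by
      simp [rotate, lower]
    have e' : rotateShift u.length ((u ++ v).length, i) = 1 := by simp [rotateShift]
    rw [e, e', add_sub_cancel_left]
    exact hy2

theorem rotate_isNode (hw : width n (u ++ v) = n) {x : ℕ × ℕ} (hx : IsNode n (u ++ v) x) :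
    IsNode (width n u) (v ++ u) (rotate u.length v.length x) := by
  by_cases h : x.1 < u.length
  · have := (rotate_above hw hx h.le).1
    rwa [rotate, if_pos h]
  · exact rotate_below hx (by omega)

/-- Rotating twice fixes all points except those of the lowest line, which return on the highest
line, one closing arc away. -/
theorem rotate_rotate {x : ℕ × ℕ} (hx : IsNode n (u ++ v) x) (hw : width n (u ++ v) = n) :
    ∃ k, Conn n (u ++ v) k x (rotate v.length u.length (rotate u.length v.length x)) := by
  by_cases h : x.1 < u.length
  · refine ⟨0, ?_⟩
    rw [rotate, rotate, if_pos h, if_neg (by simp only; omega)]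
    simpa using Conn.refl _
  · have hx1 := hx.1
    rw [List.length_append] at hx1
    by_cases h' : x.1 - u.length < v.length
    · refine ⟨0, ?_⟩
      rw [rotate, rotate, if_neg h, if_pos h']
      have : u.length + (x.1 - u.length) = x.1 := by omega
      rw [this]
      exact .refl _
    · refine ⟨1, ?_⟩
      rw [rotate, rotate, if_neg h, if_neg h']
      have e1 : x.1 - u.length - v.length = 0 := by omega
      have e2 : x = ((u ++ v).length, x.2) := by
        ext
        · simp; omega
        · rfl
      rw [e2] at hx
      rw [e1]
      nth_rewrite 1 [e2]
      refine .arc hx ⟨Nat.zero_le _, ?_⟩ (.close _)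
      have := hx.2
      rwa [List.take_length, hw] at this

/-- The bracket of the annular closure is a trace. -/
theorem annularBracket_rotate (hw : width n (u ++ v) = n) :
    annularBracket n (u ++ v) = annularBracket (width n u) (v ++ u) := by
  have hn : width (width n u) v = n := by rwa [← width_append]
  have hw' : width (width n u) (v ++ u) = width n u := by rw [width_append, hn]
  rw [annularBracket_eq_value, annularBracket_eq_value]
  refine GainSystem.value_congr (rotate u.length v.length) (rotateShift u.length)
    (rotate v.length u.length) (rotateShift v.length) (fun x hx => rotate_isNode hw hx) ?_
    (fun k a b h => Conn.lift (H := stackGain (width n u) (v ++ u))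
      (fun _ _ _ hx hy h => rotate_arc hw hx hy h) h) ?_
    (fun x hx => rotate_rotate hx hw) (fun x hx => rotate_rotate hx hw')
  · intro x hx
    have := rotate_isNode hw' hx
    rwa [hn] at this
  · intro k a b h
    refine Conn.lift (H := stackGain n (u ++ v)) (fun _ _ _ hx hy h => ?_) h
    have := rotate_arc hw' hx hy h
    rwa [hn] at this

end Rotation

/-! ### Linear combinations of stacks modulo the local relations -/

noncomputable section

theorem diagram_nil : diagram [] = 1 := map_one _

theorem diagram_append (u v : List Slice) : diagram (u ++ v) = diagram u * diagram v := by
  rw [diagram, FreeMonoid.ofList_append, map_mul]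
  rfl

/-- The trace in the annulus as a linear map. -/
def annularTraceₗ (n : ℕ) : Tangles →ₗ[K] K[X] :=
  Finsupp.linearCombination K (fun w : FreeMonoid Slice => annularBracket n w.toList) ∘ₗ
    (MonoidAlgebra.coeffLinearEquiv K).toLinearMap

theorem annularTraceₗ_apply (n : ℕ) (f : Tangles) : annularTraceₗ n f = annularTrace n f := rfl

theorem annularTraceₗ_diagram (n : ℕ) (w : List Slice) :
    annularTraceₗ n (diagram w) = annularBracket n w := by
  have : annularTraceₗ n (diagram w) = Finsupp.linearCombination K
      (fun w : FreeMonoid Slice => annularBracket n w.toList) (Finsupp.single (FreeMonoid.ofList w) 1) :=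
    rfl
  rw [this, Finsupp.linearCombination_single, one_smul]
  rfl

theorem planarTrace_eq_eval (n : ℕ) (f : Tangles) :
    planarTrace n f = (annularTrace n f).eval d := by
  rw [planarTrace, annularTrace, Finsupp.sum, Finsupp.sum, eval_finsetSum]
  refine Finset.sum_congr rfl fun w _ => ?_
  rw [eval_smul, eval_annularBracket]

/-- The span of the local relations in stacks with `N` points at the top. -/
def relations (N : ℕ) : Submodule K Tangles :=
  Submodule.span K {x | ∃ u p r q v, LocalRel (width N u) p r q ∧
    x = diagram (u ++ p ++ v) - r • diagram (u ++ q ++ v)}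

theorem LocalRel.smodEq {N : ℕ} {u p q : List Slice} {r : K} (h : LocalRel (width N u) p r q)
    (v : List Slice) :
    diagram (u ++ p ++ v) ≡ r • diagram (u ++ q ++ v) [SMOD relations N] :=
  SModEq.sub_mem.2 (Submodule.subset_span ⟨u, p, r, q, v, h, rfl⟩)

theorem annularTraceₗ_eq_of_smodEq {N : ℕ} {x y : Tangles} (h : x ≡ y [SMOD relations N]) :
    annularTraceₗ N x = annularTraceₗ N y := by
  have hle : relations N ≤ LinearMap.ker (annularTraceₗ N) := by
    refine Submodule.span_le.2 ?_
    rintro _ ⟨u, p, r, q, v, h, rfl⟩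
    rw [SetLike.mem_coe, LinearMap.mem_ker, map_sub, map_smul, annularTraceₗ_diagram,
      annularTraceₗ_diagram, h.annularBracket_eq, smul_eq_C_mul, sub_self]
  have := hle (SModEq.sub_mem.1 h)
  rwa [LinearMap.mem_ker, map_sub, sub_eq_zero] at this

theorem span_range_diagram : Submodule.span K (Set.range diagram) = ⊤ := by
  refine eq_top_iff.2 fun x _ => ?_
  induction x using MonoidAlgebra.induction_on with
  | of w => exact Submodule.subset_span ⟨w.toList, rfl⟩
  | add x y hx hy => exact add_mem (hx trivial) (hy trivial)
  | smul r x hx => exact Submodule.smul_mem _ r (hx trivial)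

/-- Stacking below leaves the strand counts above unchanged, so `relations N` is a right ideal.
Stacking on top changes the number of strands at which a relation is applied; `mul_relations_mem`
keeps track of this. -/
theorem relations_mul_mem {N : ℕ} {x : Tangles} (hx : x ∈ relations N) (y : Tangles) :
    x * y ∈ relations N := by
  have hy : y ∈ Submodule.span K (Set.range diagram) := by rw [span_range_diagram]; trivial
  induction hy using Submodule.span_induction with
  | mem y hy =>
    obtain ⟨w, rfl⟩ := hy
    induction hx using Submodule.span_induction with
    | mem x hx =>
      obtain ⟨u, p, r, q, v, h, rfl⟩ := hx
      rw [sub_mul, smul_mul_assoc, ← diagram_append, ← diagram_append]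
      exact Submodule.subset_span ⟨u, p, r, q, v ++ w, h, by simp⟩
    | zero => rw [zero_mul]; exact zero_mem _
    | add x x' _ _ h h' => rw [add_mul]; exact add_mem h h'
    | smul r x _ h => rw [smul_mul_assoc]; exact Submodule.smul_mem _ r h
  | zero => rw [mul_zero]; exact zero_mem _
  | add y y' _ _ h h' => rw [mul_add]; exact add_mem h h'
  | smul r y _ h => rw [mul_smul_comm]; exact Submodule.smul_mem _ r h

theorem mul_relations_mem {N : ℕ} (w : List Slice) {x : Tangles} (hx : x ∈ relations (width N w)) :
    diagram w * x ∈ relations N := by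
  induction hx using Submodule.span_induction with
  | mem x hx =>
    obtain ⟨u, p, r, q, v, h, rfl⟩ := hx
    rw [mul_sub, mul_smul_comm, ← diagram_append, ← diagram_append]
    exact Submodule.subset_span ⟨w ++ u, p, r, q, v, by rwa [width_append], by simp⟩
  | zero => rw [mul_zero]; exact zero_mem _
  | add x x' _ _ h h' => rw [mul_add]; exact add_mem h h'
  | smul r x _ h => rw [mul_smul_comm]; exact Submodule.smul_mem _ r h

theorem smodEq_mul_right {N : ℕ} {x y : Tangles} (h : x ≡ y [SMOD relations N]) (z : Tangles) :
    x * z ≡ y * z [SMOD relations N] := by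
  rw [SModEq.sub_mem, ← sub_mul]
  exact relations_mul_mem (SModEq.sub_mem.1 h) z

theorem smodEq_append {N : ℕ} {r : K} {w w' : List Slice}
    (h : diagram w ≡ r • diagram w' [SMOD relations N]) (v : List Slice) :
    diagram (w ++ v) ≡ r • diagram (w' ++ v) [SMOD relations N] := by
  rw [diagram_append, diagram_append, ← smul_mul_assoc]
  exact smodEq_mul_right h _

theorem smodEq_prepend {N : ℕ} {r : K} (u : List Slice) {w w' : List Slice}
    (h : diagram w ≡ r • diagram w' [SMOD relations (width N u)]) :
    diagram (u ++ w) ≡ r • diagram (u ++ w') [SMOD relations N] := by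
  rw [diagram_append, diagram_append, ← mul_smul_comm, SModEq.sub_mem, ← mul_sub]
  exact mul_relations_mem u (SModEq.sub_mem.1 h)

theorem width_mono {m n : ℕ} (h : m ≤ n) (w : List Slice) : width m w ≤ width n w := by
  induction w generalizing m n with
  | nil => exact h
  | cons s w ih =>
    refine ih ?_
    cases s <;> simp only [Slice.below] <;> omega

theorem LocalRel.mono {m n : ℕ} (hmn : m ≤ n) {p q : List Slice} {r : K} (h : LocalRel m p r q) :
    LocalRel n p r q := by
  cases h <;> constructor <;> omega

/-- A relation that fits on `m` strands also fits beside further strands. Thus one reduction to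
normal form serves for `n` and for `n + 1` strands. -/
theorem relations_mono {m n : ℕ} (h : m ≤ n) : relations m ≤ relations n := by
  refine Submodule.span_mono ?_
  rintro _ ⟨u, p, r, q, v, hr, rfl⟩
  exact ⟨u, p, r, q, v, hr.mono (width_mono h u), rfl⟩

/-! ### Valid stacks and their normal form -/

/-- All slices of the stack fit on the strands that are present. -/
def Valid : ℕ → List Slice → Prop
  | _, [] => True
  | n, s :: w => s.Fits n ∧ Valid (s.below n) w

theorem valid_append {n : ℕ} {u v : List Slice} :
    Valid n (u ++ v) ↔ Valid n u ∧ Valid (width n u) v := by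
  induction u generalizing n with
  | nil => simp [Valid, width_nil]
  | cons s u ih => simp [Valid, width_cons, ih, and_assoc]

theorem valid_singleton {n : ℕ} {s : Slice} : Valid n [s] ↔ s.Fits n := by simp [Valid]

theorem Valid.succ {n : ℕ} {w : List Slice} (h : Valid n w) :
    Valid (n + 1) w ∧ width (n + 1) w = width n w + 1 := by
  induction w generalizing n with
  | nil => exact ⟨trivial, rfl⟩
  | cons s w ih =>
    obtain ⟨h1, h2⟩ := h
    have e : s.below (n + 1) = s.below n + 1 := by
      cases s <;> simp only [Slice.below, Slice.Fits] at * <;> omega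
    rw [width_cons, width_cons, Valid, e]
    refine ⟨⟨?_, (ih h2).1⟩, (ih h2).2⟩
    cases s <;> simp only [Slice.Fits] at * <;> omega

theorem Valid.add {n : ℕ} {w : List Slice} (h : Valid n w) (k : ℕ) :
    Valid (n + k) w ∧ width (n + k) w = width n w + k := by
  induction k with
  | zero => exact ⟨h, rfl⟩
  | succ k ih =>
    have := ih.1.succ
    exact ⟨this.1, by rw [← add_assoc, this.2, ih.2, add_assoc]⟩

/-- A cap can be moved up through cups. -/
theorem exists_smodEq_cups_cap {M i : ℕ} {us : List ℕ}
    (h : Valid M (us.map Slice.cup ++ [.cap i])) :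
    ∃ (c : K) (ps us' : List ℕ), Valid M (ps.map Slice.cap ++ us'.map Slice.cup) ∧
      width M (ps.map Slice.cap ++ us'.map Slice.cup) = width M (us.map Slice.cup ++ [.cap i]) ∧
      diagram (us.map Slice.cup ++ [.cap i]) ≡
        c • diagram (ps.map Slice.cap ++ us'.map Slice.cup) [SMOD relations M] := by
  induction us using List.reverseRecOn generalizing i with
  | nil => exact ⟨1, [i], [], by simpa using h, rfl, by rw [one_smul]; rfl⟩
  | append_singleton us j ih =>
    simp only [List.map_append, List.map_cons, List.map_nil] at h ih ⊢
    rw [List.append_assoc, valid_append] at h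
    obtain ⟨h1, hj, hi, -⟩ := h
    set W := width M (us.map Slice.cup) with hW
    have hwidth : ∀ s t, width M (us.map Slice.cup ++ [s] ++ [t]) = t.below (s.below W) := by
      intro s t
      rw [List.append_assoc, width_append]
      rfl
    simp only [Slice.Fits, Slice.below] at hj hi
    -- the cap and the last cup can be removed
    have remove : ∀ r, LocalRel W [.cup j, .cap i] r [] →
        ∃ (c : K) (ps us' : List ℕ), Valid M (ps.map Slice.cap ++ us'.map Slice.cup) ∧
          width M (ps.map Slice.cap ++ us'.map Slice.cup) =
            width M (us.map Slice.cup ++ [.cup j] ++ [.cap i]) ∧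
          diagram (us.map Slice.cup ++ [.cup j] ++ [.cap i]) ≡
            c • diagram (ps.map Slice.cap ++ us'.map Slice.cup) [SMOD relations M] := by
      intro r hr
      refine ⟨r, [], us, by simpa using h1, ?_, ?_⟩
      · rw [hwidth]
        simp [Slice.below, hW]
      · have := hr.smodEq (N := M) []
        simpa using this
    -- the cap and the last cup can be exchanged
    have exchange : ∀ i' j', LocalRel W [.cup j, .cap i] 1 [.cap i', .cup j'] → i' + 2 ≤ W →
        j' + 2 ≤ W →
        ∃ (c : K) (ps us' : List ℕ), Valid M (ps.map Slice.cap ++ us'.map Slice.cup) ∧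
          width M (ps.map Slice.cap ++ us'.map Slice.cup) =
            width M (us.map Slice.cup ++ [.cup j] ++ [.cap i]) ∧
          diagram (us.map Slice.cup ++ [.cup j] ++ [.cap i]) ≡
            c • diagram (ps.map Slice.cap ++ us'.map Slice.cup) [SMOD relations M] := by
      intro i' j' hr hi' hj'
      obtain ⟨c, ps, us', hv, hw, hc⟩ := ih (valid_append.2 ⟨h1, valid_singleton.2 hi'⟩)
      have hw' : width M (us.map Slice.cup ++ [.cap i']) = W - 2 := by
        rw [width_append]
        rfl
      refine ⟨c, ps, us' ++ [j'], ?_, ?_, ?_⟩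
      · rw [List.map_append, ← List.append_assoc, valid_append, hw, hw']
        exact ⟨hv, valid_singleton.2 (by simp only [Slice.Fits]; omega)⟩
      · rw [List.map_append, ← List.append_assoc, width_append, hw, hw', hwidth]
        simp only [List.map_cons, List.map_nil, width_cons, width_nil, Slice.below]
        omega
      · have h2 := hr.smodEq (N := M) []
        rw [one_smul] at h2
        simp only [List.append_nil] at h2
        have h3 := smodEq_append hc [.cup j']
        simp only [List.append_assoc, List.map_append, List.map_cons, List.map_nil,
          List.cons_append, List.nil_append] at h2 h3 ⊢
        exact h2.trans h3
    -- A cap right below a cup closes a circle, straightens a zigzag when the positions differ by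
    -- one, and slides past the cup otherwise.
    obtain h | h | h | h | h : i = j ∨ i = j + 1 ∨ j = i + 1 ∨ i + 2 ≤ j ∨ j + 2 ≤ i := by omega
    · subst h
      exact remove d (.circle i hj)
    · subst h
      exact remove 1 (.cup_cap_succ j (by omega))
    · subst h
      exact remove 1 (.cup_succ_cap i (by omega))
    · obtain ⟨j, rfl⟩ : ∃ k, j = k + 2 := ⟨j - 2, by omega⟩
      exact exchange i j (.cup_cap_left i j (by omega) hj) (by omega) hj
    · obtain ⟨i, rfl⟩ : ∃ k, i = k + 2 := ⟨i - 2, by omega⟩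
      exact exchange i j (.cup_cap_right i j (by omega) (by omega)) (by omega) (by omega)

/-- Modulo the local relations, every valid stack is a multiple of a stack of caps followed by
cups. -/
theorem Valid.exists_smodEq {N : ℕ} {w : List Slice} (h : Valid N w) :
    ∃ (c : K) (ps us : List ℕ), Valid N (ps.map Slice.cap ++ us.map Slice.cup) ∧
      width N (ps.map Slice.cap ++ us.map Slice.cup) = width N w ∧
      diagram w ≡ c • diagram (ps.map Slice.cap ++ us.map Slice.cup) [SMOD relations N] := by
  induction w using List.reverseRecOn with
  | nil => exact ⟨1, [], [], trivial, rfl, by rw [one_smul]; rfl⟩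
  | append_singleton w s ih =>
    rw [valid_append] at h
    obtain ⟨c, ps, us, hv, hw, hc⟩ := ih h.1
    have hs := h.2
    rw [← hw] at hs
    cases s with
    | cup j =>
      refine ⟨c, ps, us ++ [j], ?_, ?_, ?_⟩
      · rw [List.map_append, ← List.append_assoc]
        exact valid_append.2 ⟨hv, hs⟩
      · rw [List.map_append, ← List.append_assoc, width_append N (_ ++ _), hw, width_append]
        rfl
      · rw [List.map_append, ← List.append_assoc]
        exact smodEq_append hc _
    | cap i =>
      have hv' := valid_append.2 ⟨hv, hs⟩
      rw [List.append_assoc, valid_append] at hv'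
      obtain ⟨c', ps', us', hv1, hw1, hc1⟩ := exists_smodEq_cups_cap hv'.2
      refine ⟨c * c', ps ++ ps', us', ?_, ?_, ?_⟩
      · rw [List.map_append, List.append_assoc]
        exact valid_append.2 ⟨hv'.1, hv1⟩
      · rw [List.map_append, List.append_assoc, width_append, hw1, ← width_append,
          ← List.append_assoc, width_append N (_ ++ _), hw, ← width_append]
      · rw [List.map_append, List.append_assoc, mul_smul]
        refine (smodEq_append hc _).trans (SModEq.smul ?_ _)
        rw [List.append_assoc]
        exact smodEq_prepend _ hc1

theorem width_cups (n : ℕ) (us : List ℕ) : width n (us.map Slice.cup) = n + 2 * us.length := by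
  induction us generalizing n with
  | nil => rfl
  | cons i us ih =>
    rw [List.map_cons, width_cons, ih, List.length_cons]
    simp only [Slice.below]
    omega

theorem width_caps_le (n : ℕ) (ps : List ℕ) : width n (ps.map Slice.cap) ≤ n := by
  induction ps generalizing n with
  | nil => exact le_rfl
  | cons i ps ih =>
    rw [List.map_cons, width_cons]
    exact (ih _).trans (by simp only [Slice.below]; omega)

/-- An additional strand around the annulus multiplies the bracket by the variable. -/
theorem annularBracket_succ {n : ℕ} {w : List Slice} (h : Valid n w) (hw : width n w = n) :
    annularBracket (n + 1) w = X * annularBracket n w := by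
  induction n using Nat.strong_induction_on generalizing w with
  | _ n ih =>
    obtain ⟨c, ps, us, hv, hw', hc⟩ := h.exists_smodEq
    rw [hw] at hw'
    have h0 := annularTraceₗ_eq_of_smodEq hc
    have hc' : diagram w ≡ c • diagram (ps.map Slice.cap ++ us.map Slice.cup)
        [SMOD relations (n + 1)] :=
      SModEq.sub_mem.2 (relations_mono n.le_succ (SModEq.sub_mem.1 hc))
    have h1 := annularTraceₗ_eq_of_smodEq hc'
    rw [map_smul, annularTraceₗ_diagram, annularTraceₗ_diagram] at h0 h1
    rw [h0, h1, mul_smul_comm]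
    congr 1
    cases ps with
    | nil =>
      -- Without caps, equal widths at both ends leave no room for cups.
      have hus : us = [] := by
        have := hw'
        rw [List.map_nil, List.nil_append, width_cups] at this
        exact List.length_eq_zero_iff.1 (by omega)
      subst hus
      simp only [List.map_nil, List.append_nil, annularBracket_nil, pow_succ']
    | cons i ps =>
      set P := (i :: ps).map Slice.cap with hP
      set U := us.map Slice.cup with hU
      -- After a cap the middle line has fewer than `n` points. Rotating the closure so that it
      -- starts there makes the induction hypothesis applicable.
      have hlt : width n P < n := by
        have hi : i + 2 ≤ n := hv.1
        rw [hP, List.map_cons, width_cons]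
        exact (width_caps_le _ _).trans_lt (by simp only [Slice.below]; omega)
      obtain ⟨hvP, hvU⟩ := valid_append.1 hv
      have hU' : width (width n P) U = n := by rw [← width_append, hw']
      have hv1 : Valid (width n P) (U ++ P) := by
        rw [valid_append, hU']
        exact ⟨hvU, hvP⟩
      have hw1 : width (width n P) (U ++ P) = width n P := by rw [width_append, hU']
      rw [annularBracket_rotate hw', ← ih _ hlt hv1 hw1,
        annularBracket_rotate (by rw [hv.succ.2, hw']), hvP.succ.2]

/-- A cup to the right of all strands can be moved to the bottom. -/
theorem Valid.smodEq_cup {k : ℕ} {w : List Slice} (h : Valid k w) :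
    diagram (.cup k :: w) ≡ (1 : K) • diagram (w ++ [.cup (width k w)]) [SMOD relations k] := by
  induction w generalizing k with
  | nil => rw [one_smul]; rfl
  | cons s w ih =>
    obtain ⟨hs, h⟩ := h
    have h1 : diagram ([] ++ [.cup k, s] ++ w) ≡
        (1 : K) • diagram ([] ++ [s, .cup (s.below k)] ++ w) [SMOD relations k] := by
      refine LocalRel.smodEq ?_ w
      cases s with
      | cap i =>
        simp only [Slice.Fits] at hs
        obtain ⟨k, rfl⟩ : ∃ l, k = l + 2 := ⟨k - 2, by omega⟩
        exact .cup_cap_left i k (by omega) (by simp [width_nil])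
      | cup i => exact .cup_cup i k hs le_rfl
    have h2 := smodEq_prepend (N := k) [s] (ih h)
    rw [one_smul] at h1 h2 ⊢
    exact h1.trans h2

/-- The bracket of a closed stack with an additional cap and cup. -/
theorem annularBracket_cap_cup {k : ℕ} {w : List Slice} (h : Valid k w) (hw : width k w = k) :
    annularBracket (k + 2) (w ++ [.cap k, .cup k]) = C d * annularBracket k w := by
  have h2 := h.add 2
  rw [hw] at h2
  have e : w ++ [.cap k, .cup k] = (w ++ [.cap k]) ++ [.cup k] := by simp
  have e1 : width (k + 2) (w ++ [.cap k]) = k := by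
    rw [width_append, h2.2]
    simp [width_cons, width_nil, Slice.below]
  -- The final cup is rotated to the top and slid down along `w` until it meets the cap, where it
  -- closes a circle.
  rw [e, annularBracket_rotate (by rw [width_append, e1]; rfl), e1]
  have h3 := annularTraceₗ_eq_of_smodEq (smodEq_append h.smodEq_cup [.cap k])
  rw [one_smul, annularTraceₗ_diagram, annularTraceₗ_diagram, hw] at h3
  rw [← List.append_assoc]
  have h4 := (LocalRel.circle (m := width k w) k hw.ge).annularBracket_eq (n := k) (v := [])
  simpa using h3.trans (by simpa using h4)

/-- The bracket of a closed stack with two additional caps and cups. -/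
theorem annularBracket_cap_cup_cap_cup {k : ℕ} {w : List Slice} (h : Valid (k + 1) w)
    (hw : width (k + 1) w = k + 1) :
    annularBracket (k + 3) (w ++ [.cap k, .cup k, .cap (k + 1), .cup (k + 1)]) =
      annularBracket (k + 1) w := by
  have h2 := h.add 2
  rw [hw] at h2
  have e1 : width (k + 1 + 2) (w ++ [.cap k]) = k + 1 := by
    rw [width_append, h2.2]
    simp [width_cons, width_nil, Slice.below]
  -- The inner cup and cap form a zigzag. Once it is removed, rotating and sliding the remaining cup
  -- produces a second zigzag.
  have h1 := (LocalRel.cup_cap_succ (m := width (k + 1 + 2) (w ++ [.cap k])) k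
    (by omega)).annularBracket_eq (v := [.cup (k + 1)])
  have e : w ++ [.cap k, .cup k, .cap (k + 1), .cup (k + 1)] =
    w ++ [.cap k] ++ [.cup k, .cap (k + 1)] ++ [.cup (k + 1)] := by simp
  rw [e, show k + 3 = k + 1 + 2 from rfl, h1, List.append_nil, C_1, one_mul,
    annularBracket_rotate (by rw [width_append, e1]; rfl), e1]
  have h3 := annularTraceₗ_eq_of_smodEq (smodEq_append h.smodEq_cup [.cap k])
  rw [one_smul, annularTraceₗ_diagram, annularTraceₗ_diagram, hw] at h3
  have h4 := (LocalRel.cup_succ_cap (m := width (k + 1) w) k (by omega)).annularBracket_eq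
    (n := k + 1) (v := [])
  simpa using h3.trans (by simpa using h4)

end

noncomputable section

/-! ### Quantum integers -/

theorem A_pow_injective : Function.Injective fun n : ℕ => A ^ n := by
  intro m n h
  have h : algebraMap ℚ[X] K (X ^ m) = algebraMap ℚ[X] K (X ^ n) := by
    simpa [RatFunc.algebraMap_X, A] using h
  have := congrArg natDegree (RatFunc.algebraMap_injective ℚ h)
  simpa using this

theorem A_ne_zero : A ≠ 0 := RatFunc.X_ne_zero

theorem A_pow_ne_one {n : ℕ} (hn : n ≠ 0) : A ^ n ≠ 1 := fun h =>
  hn (A_pow_injective (by simpa using h))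

theorem A_pow_sub_ne_zero {n : ℕ} (hn : n ≠ 0) : A ^ n - (A ^ n)⁻¹ ≠ 0 := by
  intro h
  have h0 : A ^ n ≠ 0 := pow_ne_zero _ A_ne_zero
  refine A_pow_ne_one (n := n + n) (by omega) ?_
  rw [pow_add]
  nth_rewrite 1 [sub_eq_zero.1 h]
  exact inv_mul_cancel₀ h0

/-- The quantum integer `1 + q + ⋯ + q^(n-1)` with `q = A⁴`. -/
def quantumInt (n : ℕ) : K := ∑ k ∈ Finset.range n, (A ^ 4) ^ k

theorem quantumInt_zero : quantumInt 0 = 0 := by simp [quantumInt]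

theorem quantumInt_one : quantumInt 1 = 1 := by simp [quantumInt]

theorem quantumInt_succ (n : ℕ) : quantumInt (n + 1) = 1 + A ^ 4 * quantumInt n := by
  rw [quantumInt, Finset.sum_range_succ', pow_zero, add_comm, quantumInt, Finset.mul_sum]
  congr 1
  exact Finset.sum_congr rfl fun k _ => pow_succ' _ _

theorem quantumInt_mul (n : ℕ) : quantumInt n * (A ^ 4 - 1) = A ^ (4 * n) - 1 := by
  rw [quantumInt, geom_sum_mul, ← pow_mul]

theorem quantumInt_ne_zero {n : ℕ} (hn : n ≠ 0) : quantumInt n ≠ 0 := by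
  intro h
  have := quantumInt_mul n
  rw [h, zero_mul, eq_comm, sub_eq_zero] at this
  exact A_pow_ne_one (by omega) this

theorem quantumFactorial_zero : quantumFactorial 0 = 1 := by simp [quantumFactorial]

theorem quantumFactorial_succ (n : ℕ) :
    quantumFactorial (n + 1) = quantumFactorial n * quantumInt (n + 1) :=
  Finset.prod_range_succ _ _

theorem quantumFactorial_ne_zero (n : ℕ) : quantumFactorial n ≠ 0 :=
  Finset.prod_ne_zero_iff.2 fun m _ => quantumInt_ne_zero m.succ_ne_zero

theorem A_sq_mul_d : A ^ 2 * d = -A ^ 4 - 1 := by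
  have := A_ne_zero
  rw [d]
  field_simp

theorem d_ne_zero : d ≠ 0 := by
  intro h
  have h1 := A_sq_mul_d
  rw [h, mul_zero] at h1
  have h2 : A ^ 4 = -1 := by linear_combination h1
  refine A_pow_ne_one (n := 8) (by norm_num) ?_
  rw [show A ^ 8 = (A ^ 4) ^ 2 by ring, h2]
  norm_num

/-- This evaluates the factor that arises from closing one strand trivially in
`annularTraceₗ_symmetrizer_mul_e`. -/
theorem A_sq_mul_d_mul_quantumInt (n : ℕ) :
    A ^ 2 * (d * quantumInt (n + 1) + A ^ 2 * quantumInt n) = -quantumInt (n + 2) := by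
  rw [quantumInt_succ (n + 1), quantumInt_succ n]
  linear_combination (1 + A ^ 4 * quantumInt n) * A_sq_mul_d

/-! ### Symmetrizers in algebras with Temperley-Lieb generators -/

section TemperleyLieb

variable {R : Type} [Ring R] [Algebra K R]

/-- The elements `e 0, …, e (N - 2)` satisfy the relations of the Temperley-Lieb algebra. -/
structure IsTemperleyLieb (e : ℕ → R) (N : ℕ) : Prop where
  sq : ∀ i, i + 2 ≤ N → e i * e i = d • e i
  up : ∀ i, i + 3 ≤ N → e i * e (i + 1) * e i = e i
  down : ∀ i, i + 3 ≤ N → e (i + 1) * e i * e (i + 1) = e (i + 1)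
  comm : ∀ i j, i + 2 ≤ j → j + 2 ≤ N → e i * e j = e j * e i

/-- The rescaled crossing `A³ σ = A⁴ + A² e`. -/
def crossing (e : ℕ → R) (i : ℕ) : R := A ^ 4 • (1 : R) + A ^ 2 • e i

/-- The sum of the minimal positive braids `T (n - 1) ⋯ T (n - k)` for `k ≤ n`. -/
def cosetSum (e : ℕ → R) : ℕ → R
  | 0 => 1
  | n + 1 => 1 + crossing e n * cosetSum e n

/-- The sum of the minimal positive braids of all permutations of `n` strands. -/
def symmetrizer (e : ℕ → R) : ℕ → R
  | 0 => 1
  | n + 1 => symmetrizer e n * cosetSum e n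

namespace IsTemperleyLieb

variable {e : ℕ → R} {N : ℕ}

/-- Resolving the curl gives `A⁴ + A² d = -1`: the rescaling by `A³` turns the curl factor `-A⁻³`
into `-1`. -/
theorem crossing_mul_self (h : IsTemperleyLieb e N) {i : ℕ} (hi : i + 2 ≤ N) :
    crossing e i * e i = -e i := by
  rw [crossing, add_mul, smul_mul_assoc, smul_mul_assoc, one_mul, h.sq i hi, smul_smul, ← add_smul,
    A_sq_mul_d, show A ^ 4 + (-A ^ 4 - 1) = -1 by ring, neg_one_smul]

/-- This is the isotopy that slides a turn through two crossings. Algebraically, the multiples of `e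
(i + 1)` cancel because `-A⁴ + A² A² = 0`. -/
theorem crossing_mul_crossing_mul (h : IsTemperleyLieb e N) {i : ℕ} (hi : i + 3 ≤ N) :
    crossing e (i + 1) * crossing e i * e (i + 1) = A ^ 6 • (e i * e (i + 1)) := by
  have e1 : crossing e (i + 1) * (e i * e (i + 1)) = A ^ 4 • (e i * e (i + 1)) +
      A ^ 2 • e (i + 1) := by
    rw [crossing, add_mul, smul_mul_assoc, smul_mul_assoc, one_mul, ← mul_assoc, h.down i hi]
  have e2 : crossing e i * e (i + 1) = A ^ 4 • e (i + 1) + A ^ 2 • (e i * e (i + 1)) := by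
    rw [crossing, add_mul, smul_mul_assoc, smul_mul_assoc, one_mul]
  rw [mul_assoc, e2, mul_add, mul_smul_comm, mul_smul_comm, h.crossing_mul_self (by omega), e1,
    smul_add, smul_smul, smul_smul, ← pow_add, ← pow_add, smul_neg]
  exact neg_add_cancel_comm_assoc _ _

theorem commute_crossing (h : IsTemperleyLieb e N) {i j : ℕ} (hij : i + 2 ≤ j) (hj : j + 2 ≤ N) :
    Commute (e i) (crossing e j) :=
  (((Commute.one_right _).smul_right _).add_right
    (Commute.smul_right (h.comm i j hij hj) _))

theorem crossing_commute (h : IsTemperleyLieb e N) {i j : ℕ} (hij : i + 2 ≤ j) (hj : j + 2 ≤ N) :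
    Commute (crossing e i) (e j) :=
  (((Commute.one_left _).smul_left _).add_left
    (Commute.smul_left (h.comm i j hij hj) _))

theorem cosetSum_commute (h : IsTemperleyLieb e N) {j n : ℕ} (hn : n + 1 ≤ j) (hj : j + 2 ≤ N) :
    Commute (cosetSum e n) (e j) := by
  induction n with
  | zero => exact Commute.one_left _
  | succ n ih =>
    exact (Commute.one_left _).add_left
      ((h.crossing_commute (by omega) hj).mul_left (ih (by omega)))

/-- `cosetSum e n * e i` lies in the right ideal generated by the `e k` with `k + 2 ≤ n`. -/
theorem cosetSum_mul_mem (h : IsTemperleyLieb e N) {n i : ℕ} (hi : i + 1 ≤ n) (hn : n + 1 ≤ N) :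
    cosetSum e n * e i ∈ Submodule.span K {x | ∃ k y, k + 2 ≤ n ∧ x = e k * y} := by
  induction n generalizing i with
  | zero => omega
  | succ n ih =>
    rw [cosetSum, add_mul, one_mul]
    obtain hi | rfl : i + 1 ≤ n ∨ i = n := by omega
    · refine add_mem (Submodule.subset_span ⟨i, 1, by omega, by rw [mul_one]⟩) ?_
      have h1 := ih hi (by omega)
      rw [mul_assoc]
      generalize cosetSum e n * e i = x at h1
      induction h1 using Submodule.span_induction with
      | mem x hx =>
        obtain ⟨k, y, hk, rfl⟩ := hx
        refine Submodule.subset_span ⟨k, crossing e n * y, by omega, ?_⟩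
        rw [← mul_assoc, ← (h.commute_crossing hk hn).eq, mul_assoc]
      | zero => rw [mul_zero]; exact zero_mem _
      | add x y _ _ hx hy => rw [mul_add]; exact add_mem hx hy
      | smul r x _ hx => rw [mul_smul_comm]; exact Submodule.smul_mem _ r hx
    · cases i with
      | zero =>
        rw [cosetSum, mul_one, h.crossing_mul_self hn, add_neg_cancel]
        exact zero_mem _
      | succ n =>
        -- The terms without a second crossing cancel by the curl relation. In the remaining one, `e
        -- (n + 1)` commutes with the shorter coset sum and slides through two crossings, becoming
        -- `e n`.
        have e1 : e (n + 1) + crossing e (n + 1) * cosetSum e (n + 1) * e (n + 1) =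
            e n * (A ^ 6 • (e (n + 1) * cosetSum e n)) := by
          rw [cosetSum, mul_add, mul_one, add_mul, h.crossing_mul_self hn, add_neg_cancel_left,
            mul_smul_comm, ← mul_assoc (e n), ← smul_mul_assoc, ← h.crossing_mul_crossing_mul hn]
          simp only [mul_assoc]
          rw [(h.cosetSum_commute le_rfl hn).eq]
        rw [e1]
        exact Submodule.subset_span ⟨n, _, le_rfl, rfl⟩

/-- The last coset sum exchanges `e i` for generators on one strand fewer, which the smaller
symmetrizer already annihilates. -/
theorem symmetrizer_mul (h : IsTemperleyLieb e N) {n i : ℕ} (hi : i + 2 ≤ n) (hn : n ≤ N) :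
    symmetrizer e n * e i = 0 := by
  induction n generalizing i with
  | zero => omega
  | succ n ih =>
    rw [symmetrizer, mul_assoc]
    have h1 := h.cosetSum_mul_mem (n := n) (i := i) (by omega) hn
    generalize cosetSum e n * e i = x at h1
    induction h1 using Submodule.span_induction with
    | mem x hx =>
      obtain ⟨k, y, hk, rfl⟩ := hx
      rw [← mul_assoc, ih hk (by omega), zero_mul]
    | zero => rw [mul_zero]
    | add x y _ _ hx hy => rw [mul_add, hx, hy, add_zero]
    | smul r x _ hx => rw [mul_smul_comm, hx, smul_zero]

theorem op (h : IsTemperleyLieb e N) : IsTemperleyLieb (fun i => MulOpposite.op (e i)) N where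
  sq i hi := by rw [← MulOpposite.op_mul, h.sq i hi, MulOpposite.op_smul]
  up i hi := by rw [← MulOpposite.op_mul, ← MulOpposite.op_mul, ← mul_assoc, h.up i hi]
  down i hi := by rw [← MulOpposite.op_mul, ← MulOpposite.op_mul, ← mul_assoc, h.down i hi]
  comm i j hij hj := by rw [← MulOpposite.op_mul, ← MulOpposite.op_mul, h.comm i j hij hj]

end IsTemperleyLieb

/-! ### Eigenvalues of symmetrizers on elements killed by the generators -/

/-- Every rescaled crossing acts on such an `x` as `q = A⁴`, so the coset sum acts as `1 + q + ⋯ +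
q^j`. -/
theorem cosetSum_mul_of_forall {e : ℕ → R} {n j : ℕ} {x : R} (hx : ∀ i, i + 2 ≤ n → e i * x = 0)
    (hj : j + 1 ≤ n) : cosetSum e j * x = quantumInt (j + 1) • x := by
  induction j with
  | zero => rw [cosetSum, one_mul, quantumInt_one, one_smul]
  | succ j ih =>
    rw [cosetSum, add_mul, one_mul, mul_assoc, ih (by omega), mul_smul_comm, crossing, add_mul,
      smul_mul_assoc, smul_mul_assoc, hx j (by omega), quantumInt_succ (j + 1)]
    rw [one_mul, smul_zero, add_zero, add_smul, one_smul, smul_smul, mul_comm]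

theorem symmetrizer_mul_of_forall {e : ℕ → R} {n : ℕ} {x : R}
    (hx : ∀ i, i + 2 ≤ n → e i * x = 0) {m : ℕ} (hm : m ≤ n) :
    symmetrizer e m * x = quantumFactorial m • x := by
  induction m with
  | zero => rw [symmetrizer, one_mul, quantumFactorial_zero, one_smul]
  | succ m ih =>
    rw [symmetrizer, mul_assoc, cosetSum_mul_of_forall hx hm, mul_smul_comm, ih (by omega),
      smul_smul, quantumFactorial_succ, mul_comm]

theorem mul_cosetSum_of_forall {e : ℕ → R} {n j : ℕ} {x : R} (hx : ∀ i, i + 2 ≤ n → x * e i = 0)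
    (hj : j + 1 ≤ n) : x * cosetSum e j = quantumInt (j + 1) • x := by
  induction j with
  | zero => rw [cosetSum, mul_one, quantumInt_one, one_smul]
  | succ j ih =>
    rw [cosetSum, mul_add, mul_one, ← mul_assoc, crossing, mul_add, mul_smul_comm, mul_smul_comm,
      hx j (by omega), smul_zero, add_zero, mul_one, smul_mul_assoc, ih (by omega),
      quantumInt_succ (j + 1), add_smul, one_smul, smul_smul]

/-- The symmetrizer also annihilates the generators from the left. -/
theorem IsTemperleyLieb.mul_symmetrizer {e : ℕ → R} {N : ℕ} (h : IsTemperleyLieb e N) {n i : ℕ}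
    (hi : i + 2 ≤ n) (hn : n ≤ N) : e i * symmetrizer e n = 0 := by
  -- The symmetrizer `g` built in the opposite ring is killed from the left. The product of the
  -- symmetrizer with `g` is `[n]!` times each of the two factors, so they are equal.
  set e' : ℕ → Rᵐᵒᵖ := fun i => MulOpposite.op (e i) with he'
  set g : R := MulOpposite.unop (symmetrizer e' n) with hg
  have hgop : MulOpposite.op g = symmetrizer e' n := MulOpposite.op_unop _
  have h1 : ∀ i, i + 2 ≤ n → e i * g = 0 := by
    intro i hi
    apply MulOpposite.op_injective
    rw [MulOpposite.op_mul, hgop, MulOpposite.op_zero]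
    exact h.op.symmetrizer_mul hi hn
  have h2 : symmetrizer e n * g = quantumFactorial n • g := symmetrizer_mul_of_forall h1 le_rfl
  have h3 : symmetrizer e n * g = quantumFactorial n • symmetrizer e n := by
    apply MulOpposite.op_injective
    rw [MulOpposite.op_mul, hgop, MulOpposite.op_smul]
    refine symmetrizer_mul_of_forall (e := e') (n := n) (fun i hi => ?_) le_rfl
    rw [he', ← MulOpposite.op_mul, h.symmetrizer_mul hi hn, MulOpposite.op_zero]
  have h4 : symmetrizer e n = g :=
    smul_right_injective R (quantumFactorial_ne_zero n) (h3.symm.trans h2)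
  rw [h4]
  exact h1 i hi

end TemperleyLieb

/-! ### The action of tangles on tangles modulo the local relations -/

/-- Left multiplication by `e i` on tangles modulo the local relations. -/
def eAct (N i : ℕ) : Module.End K (Tangles ⧸ relations N) :=
  if h : i + 2 ≤ N then
    (relations N).mapQ (relations N) (LinearMap.mulLeft K (e i)) fun x hx => by
      refine mul_relations_mem [.cap i, .cup i] ?_
      rwa [show width N [.cap i, .cup i] = N by
        simp only [width_cons, width_nil, Slice.below]; omega]
  else 0

/-- The endomorphism `r` is left multiplication by `x`. -/
def Implements (N : ℕ) (r : Module.End K (Tangles ⧸ relations N)) (x : Tangles) : Prop :=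
  ∀ y, r (Submodule.Quotient.mk y) = Submodule.Quotient.mk (x * y)

theorem implements_eAct {N i : ℕ} (h : i + 2 ≤ N) : Implements N (eAct N i) (e i) := by
  intro y
  rw [eAct, dif_pos h]
  rfl

namespace Implements

variable {N : ℕ} {r s : Module.End K (Tangles ⧸ relations N)} {x y : Tangles}

theorem one : Implements N 1 1 := fun y => by rw [one_mul]; rfl

theorem mul (h : Implements N r x) (h' : Implements N s y) : Implements N (r * s) (x * y) :=
  fun z => by rw [Module.End.mul_apply, h', h, mul_assoc]

theorem add (h : Implements N r x) (h' : Implements N s y) : Implements N (r + s) (x + y) :=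
  fun z => by rw [LinearMap.add_apply, h, h', add_mul, Submodule.Quotient.mk_add]

theorem smul (h : Implements N r x) (c : K) : Implements N (c • r) (c • x) :=
  fun z => by rw [LinearMap.smul_apply, h, smul_mul_assoc, Submodule.Quotient.mk_smul]

theorem crossing {i : ℕ} (h : i + 2 ≤ N) : Implements N (crossing (eAct N) i) (crossing e i) :=
  (one.smul _).add ((implements_eAct h).smul _)

theorem cosetSum {n : ℕ} (h : n + 1 ≤ N) : Implements N (cosetSum (eAct N) n) (cosetSum e n) := by
  induction n with
  | zero => exact one
  | succ n ih => exact one.add ((crossing h).mul (ih (by omega)))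

theorem symmetrizer {n : ℕ} (h : n ≤ N) :
    Implements N (symmetrizer (eAct N) n) (symmetrizer e n) := by
  induction n with
  | zero => exact one
  | succ n ih => exact (ih (by omega)).mul (cosetSum h)

/-- Left multiplication need not act on the quotient, so Temperley-Lieb identities are proved in the
ring `Module.End` and brought back to tangles here. -/
theorem smodEq (h : Implements N r x) (h' : Implements N s y) (hrs : r = s) (z : Tangles) :
    x * z ≡ y * z [SMOD relations N] := by
  rw [SModEq, ← h, ← h', hrs]

theorem eq_of_forall (h : Implements N r x) (h' : Implements N s y)
    (hxy : ∀ z, x * diagram z ≡ y * diagram z [SMOD relations N]) : r = s := by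
  refine LinearMap.ext fun q => ?_
  obtain ⟨z, rfl⟩ := Submodule.Quotient.mk_surjective _ q
  have hz : z ∈ Submodule.span K (Set.range diagram) := by rw [span_range_diagram]; trivial
  rw [h, h']
  induction hz using Submodule.span_induction with
  | mem z hz => obtain ⟨w, rfl⟩ := hz; exact hxy w
  | zero => rw [mul_zero, mul_zero]
  | add z z' _ _ hz hz' =>
    rw [mul_add, mul_add, Submodule.Quotient.mk_add, Submodule.Quotient.mk_add, hz, hz']
  | smul c z _ hz =>
    rw [mul_smul_comm, mul_smul_comm, Submodule.Quotient.mk_smul, Submodule.Quotient.mk_smul, hz]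

end Implements

theorem e_mul_diagram (i : ℕ) (w : List Slice) : e i * diagram w = diagram (.cap i :: .cup i :: w) := by
  rw [e, ← diagram_append]
  rfl

theorem e_mul_e (i j : ℕ) : e i * e j = diagram [.cap i, .cup i, .cap j, .cup j] :=
  e_mul_diagram _ _

/-- A local relation applied after the slices `u`. -/
theorem LocalRel.smodEq' {N m : ℕ} {u p q : List Slice} {r : K} (h : LocalRel m p r q)
    (hm : width N u = m) (v : List Slice) :
    diagram (u ++ (p ++ v)) ≡ r • diagram (u ++ (q ++ v)) [SMOD relations N] := by
  subst hm
  simpa using h.smodEq v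

/-- The generators satisfy the Temperley-Lieb relations modulo the local relations. -/
theorem isTemperleyLieb_eAct (N : ℕ) : IsTemperleyLieb (eAct N) N where
  sq i hi := by
    refine ((implements_eAct hi).mul (implements_eAct hi)).eq_of_forall
      ((implements_eAct hi).smul d) fun w => ?_
    rw [mul_assoc, e_mul_diagram, e_mul_diagram, smul_mul_assoc, e_mul_diagram]
    exact (LocalRel.circle i (m := N - 2) (by omega)).smodEq' (u := [.cap i]) rfl (.cup i :: w)
  up i hi := by
    have hi' : i + 2 ≤ N := by omega
    refine (((implements_eAct hi').mul (implements_eAct hi)).mul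
      (implements_eAct hi')).eq_of_forall (implements_eAct hi') fun w => ?_
    rw [mul_assoc, mul_assoc, e_mul_diagram, e_mul_diagram, e_mul_diagram]
    have h1 := (LocalRel.cup_cap_succ i (m := N - 2) (by omega)).smodEq' (N := N) (u := [.cap i])
      rfl ([.cup (i + 1), .cap i] ++ .cup i :: w)
    have h2 := (LocalRel.cup_succ_cap i (m := N - 2) (by omega)).smodEq' (N := N) (u := [.cap i])
      rfl (.cup i :: w)
    rw [one_smul] at h1 h2
    exact h1.trans h2
  down i hi := by
    have hi' : i + 2 ≤ N := by omega
    refine (((implements_eAct hi).mul (implements_eAct hi')).mul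
      (implements_eAct hi)).eq_of_forall (implements_eAct hi) fun w => ?_
    rw [mul_assoc, mul_assoc, e_mul_diagram, e_mul_diagram, e_mul_diagram]
    have h1 := (LocalRel.cup_succ_cap i (m := N - 2) (by omega)).smodEq' (N := N)
      (u := [.cap (i + 1)]) rfl ([.cup i, .cap (i + 1)] ++ .cup (i + 1) :: w)
    have h2 := (LocalRel.cup_cap_succ i (m := N - 2) (by omega)).smodEq' (N := N)
      (u := [.cap (i + 1)]) rfl (.cup (i + 1) :: w)
    rw [one_smul] at h1 h2
    exact h1.trans h2
  comm i j hij hj := by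
    obtain ⟨j, rfl⟩ : ∃ k, j = k + 2 := ⟨j - 2, by omega⟩
    have hi : i + 2 ≤ N := by omega
    refine ((implements_eAct hi).mul (implements_eAct hj)).eq_of_forall
      ((implements_eAct hj).mul (implements_eAct hi)) fun w => ?_
    rw [mul_assoc, mul_assoc, e_mul_diagram, e_mul_diagram, e_mul_diagram, e_mul_diagram]
    have w1 : width N [.cap i, .cap j] = N - 4 := by
      simp only [width_cons, width_nil, Slice.below]
      omega
    -- Both products reduce to the stack with caps `i`, `j` followed by cups `i`, `j + 2`.
    have h1 := (LocalRel.cup_cap_right j i (m := N - 2) (by omega) (by omega)).smodEq' (N := N)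
      (u := [.cap i]) rfl (.cup (j + 2) :: w)
    have h2 := (LocalRel.cup_cap_left i j (m := N - 2) (by omega) (by omega)).smodEq' (N := N)
      (u := [.cap (j + 2)]) rfl (.cup i :: w)
    have h3 := (LocalRel.cap_cap i j (m := N) (by omega) (by omega)).smodEq' (N := N)
      (u := []) rfl (.cup j :: .cup i :: w)
    have h4 := (LocalRel.cup_cup i j (m := N - 4) (by omega) (by omega)).smodEq' (N := N)
      (u := [.cap i, .cap j]) w1 w
    rw [one_smul] at h1 h2 h3 h4
    exact h1.trans (h2.trans (h3.trans h4)).symm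

end

noncomputable section

/-! ### The sum over all permutations -/

/-- Distributivity for ordered products, since the coset sums need not commute. -/
theorem list_prod_ofFn_sum {R : Type} [Semiring R] {n : ℕ} (h : Fin n → Finset ℕ)
    (g : Fin n → ℕ → R) :
    (List.ofFn fun j => ∑ k ∈ h j, g j k).prod =
      ∑ c ∈ Fintype.piFinset h, (List.ofFn fun j => g j (c j)).prod := by
  induction n with
  | zero => simp
  | succ n ih =>
    rw [List.ofFn_succ, List.prod_cons, ih, Finset.sum_mul_sum, ← Finset.sum_product']
    refine Finset.sum_nbij' (fun p => Fin.cons p.1 p.2) (fun c => (c 0, Fin.tail c)) ?_ ?_ ?_ ?_ ?_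
    · rintro ⟨k, c⟩ hp
      simp only [Finset.mem_product, Fintype.mem_piFinset] at hp ⊢
      intro j
      induction j using Fin.cases with
      | zero => exact hp.1
      | succ j => exact hp.2 j
    · intro c hc
      simp only [Finset.mem_product, Fintype.mem_piFinset] at hc ⊢
      exact ⟨hc 0, fun j => hc j.succ⟩
    · intro p _
      simp
    · intro c _
      simp
    · intro p _
      rw [List.ofFn_succ, List.prod_cons]
      simp

theorem lehmer_lt {n : ℕ} (π : Equiv.Perm (Fin n)) (j : Fin n) : lehmer π j < j + 1 := by
  have : lehmer π j ≤ (Finset.Iio j).card := by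
    refine Finset.card_le_card fun i hi => ?_
    simp only [Finset.mem_filter] at hi
    exact Finset.mem_Iio.2 hi.2.1
  rw [Fin.card_Iio] at this
  omega

/-- The reduced word depends on `π` only through its code, and `prod_permWord` recovers `π` from the
word. -/
theorem lehmer_injective (n : ℕ) :
    Function.Injective (lehmer : Equiv.Perm (Fin n) → Fin n → ℕ) := by
  intro π ρ h
  have hw : permWord π = permWord ρ := by rw [permWord, permWord, h]
  ext j
  rw [← prod_permWord, ← prod_permWord, hw]

/-- Codes are distinct and lie in the box, and both sets have `n!` elements. -/
theorem image_lehmer (n : ℕ) :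
    Finset.univ.image (lehmer : Equiv.Perm (Fin n) → Fin n → ℕ) =
      Fintype.piFinset fun j : Fin n => Finset.range (j + 1) := by
  refine Finset.eq_of_subset_of_card_le ?_ ?_
  · intro c hc
    obtain ⟨π, -, rfl⟩ := Finset.mem_image.1 hc
    exact Fintype.mem_piFinset.2 fun j => Finset.mem_range.2 (lehmer_lt π j)
  · rw [Finset.card_image_of_injective _ (lehmer_injective n), Fintype.card_piFinset,
      Finset.card_univ, Fintype.card_perm, Fintype.card_fin]
    simp only [Finset.card_range]
    rw [Fin.prod_univ_eq_prod_range (fun j => j + 1), Finset.prod_range_add_one_eq_factorial]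

section Symmetrizer

variable {R : Type} [Ring R] [Algebra K R]

theorem cosetSum_eq_sum (e : ℕ → R) (n : ℕ) :
    cosetSum e n = ∑ k ∈ Finset.range (n + 1),
      ((List.range k).map fun t => crossing e (n - 1 - t)).prod := by
  induction n with
  | zero => simp [cosetSum]
  | succ n ih =>
    rw [Finset.sum_range_succ', cosetSum, ih, Finset.mul_sum, add_comm]
    congr 1
    refine Finset.sum_congr rfl fun k _ => ?_
    rw [List.range_succ_eq_map, List.map_cons, List.prod_cons, List.map_map]
    congr 3
    funext t
    simp only [Function.comp_apply]
    congr 1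
    omega

theorem symmetrizer_eq_prod (e : ℕ → R) (n : ℕ) :
    symmetrizer e n = (List.ofFn fun j : Fin n => cosetSum e j).prod := by
  induction n with
  | zero => simp [symmetrizer]
  | succ n ih =>
    rw [List.ofFn_succ', List.concat_eq_append, List.prod_append, List.prod_singleton, symmetrizer,
      ih]
    rfl

/-- Expanding the product of coset sums chooses a length at most `j` for every `j`, which is the
same as choosing a Lehmer code. -/
theorem sum_perm_eq_symmetrizer (e : ℕ → R) (n : ℕ) :
    ∑ π : Equiv.Perm (Fin n), ((permWord π).map (crossing e)).prod = symmetrizer e n := by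
  simp only [symmetrizer_eq_prod, cosetSum_eq_sum]
  rw [list_prod_ofFn_sum, ← image_lehmer, Finset.sum_image fun _ _ _ _ h => lehmer_injective n h]
  refine Finset.sum_congr rfl fun π _ => ?_
  rw [permWord, List.map_flatMap, List.flatMap_def, List.prod_flatten, List.map_map,
    List.ofFn_eq_map]
  congr 2
  funext j
  simp only [Function.comp_apply, List.map_map]
  rfl

end Symmetrizer

/-- The weight supplies one factor `A³` per crossing, and `A³ σ` is the rescaled crossing. -/
theorem jonesWenzl_eq (s n : ℕ) :
    jonesWenzl s n = (quantumFactorial n)⁻¹ • symmetrizer (fun i => e (s + i)) n := by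
  rw [jonesWenzl, ← sum_perm_eq_symmetrizer]
  congr 1
  refine Finset.sum_congr rfl fun π _ => ?_
  rw [permBraid]
  generalize permWord π = l
  induction l with
  | nil => simp
  | cons i l ih =>
    rw [List.length_cons, List.map_cons, List.map_cons, List.prod_cons, List.prod_cons, ← ih,
      mul_smul_comm, pow_succ, mul_smul, ← smul_mul_assoc]
    congr 2
    have hA := A_ne_zero
    rw [sigma, smul_add, smul_smul, smul_smul, crossing]
    congr 2
    field_simp

/-! ### Combinations of closed stacks -/

/-- Linear combinations of valid stacks with `N` points at the top and at the bottom. -/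
def closedSpan (N : ℕ) : Submodule K Tangles :=
  Submodule.span K {x | ∃ w, Valid N w ∧ width N w = N ∧ x = diagram w}

theorem diagram_mem_closedSpan {N : ℕ} {w : List Slice} (h : Valid N w) (hw : width N w = N) :
    diagram w ∈ closedSpan N :=
  Submodule.subset_span ⟨w, h, hw, rfl⟩

theorem mul_mem_of_closedSpan {M N : ℕ} {s t : List Slice} (hs : Valid N s) (hsw : width N s = M)
    (ht : Valid M t) (htw : width M t = N) {x : Tangles} (hx : x ∈ closedSpan M) :
    diagram s * x * diagram t ∈ closedSpan N := by
  induction hx using Submodule.span_induction with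
  | mem x hx =>
    obtain ⟨w, h, hw, rfl⟩ := hx
    rw [← diagram_append, ← diagram_append]
    refine diagram_mem_closedSpan ?_ ?_
    · rw [valid_append, valid_append, width_append, hsw, hw]
      exact ⟨⟨hs, h⟩, ht⟩
    · rw [width_append, width_append, hsw, hw, htw]
  | zero => rw [mul_zero, zero_mul]; exact zero_mem _
  | add x y _ _ hx hy => rw [mul_add, add_mul]; exact add_mem hx hy
  | smul r x _ hx => rw [mul_smul_comm, smul_mul_assoc]; exact Submodule.smul_mem _ r hx

theorem one_mem_closedSpan (N : ℕ) : (1 : Tangles) ∈ closedSpan N := by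
  rw [← diagram_nil]
  exact diagram_mem_closedSpan trivial rfl

theorem mul_mem_closedSpan {N : ℕ} {x y : Tangles} (hx : x ∈ closedSpan N)
    (hy : y ∈ closedSpan N) : x * y ∈ closedSpan N := by
  induction hx using Submodule.span_induction with
  | mem x hx =>
    obtain ⟨w, h, hw, rfl⟩ := hx
    have := mul_mem_of_closedSpan h hw (t := []) trivial rfl hy
    rwa [diagram_nil, mul_one] at this
  | zero => rw [zero_mul]; exact zero_mem _
  | add x x' _ _ h h' => rw [add_mul]; exact add_mem h h'
  | smul r x _ h => rw [smul_mul_assoc]; exact Submodule.smul_mem _ r h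

theorem e_mem_closedSpan {N i : ℕ} (h : i + 2 ≤ N) : e i ∈ closedSpan N := by
  refine diagram_mem_closedSpan ⟨h, ?_, trivial⟩ ?_
  · simp only [Slice.Fits, Slice.below]
    omega
  · simp only [width_cons, width_nil, Slice.below]
    omega

theorem cosetSum_mem_closedSpan {N s n : ℕ} (h : s + n + 1 ≤ N) :
    cosetSum (fun i => e (s + i)) n ∈ closedSpan N := by
  induction n with
  | zero => exact one_mem_closedSpan N
  | succ n ih =>
    refine add_mem (one_mem_closedSpan N) (mul_mem_closedSpan (add_mem ?_ ?_) (ih (by omega)))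
    · exact Submodule.smul_mem _ _ (one_mem_closedSpan N)
    · exact Submodule.smul_mem _ _ (e_mem_closedSpan (by omega))

theorem symmetrizer_mem_closedSpan {N s n : ℕ} (h : s + n ≤ N) :
    symmetrizer (fun i => e (s + i)) n ∈ closedSpan N := by
  induction n with
  | zero => exact one_mem_closedSpan N
  | succ n ih => exact mul_mem_closedSpan (ih (by omega)) (cosetSum_mem_closedSpan (by omega))

theorem cosetSum_mem {N n : ℕ} (h : n + 1 ≤ N) : cosetSum e n ∈ closedSpan N := by
  simpa using cosetSum_mem_closedSpan (s := 0) (show 0 + n + 1 ≤ N by omega)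

theorem symmetrizer_mem {N n : ℕ} (h : n ≤ N) : symmetrizer e n ∈ closedSpan N := by
  simpa using symmetrizer_mem_closedSpan (s := 0) (show 0 + n ≤ N by omega)

theorem annularTraceₗ_mul_comm {N : ℕ} {x y : Tangles} (hx : x ∈ closedSpan N)
    (hy : y ∈ closedSpan N) : annularTraceₗ N (x * y) = annularTraceₗ N (y * x) := by
  induction hx using Submodule.span_induction with
  | mem x hx =>
    induction hy using Submodule.span_induction with
    | mem y hy =>
      obtain ⟨w, h, hw, rfl⟩ := hx
      obtain ⟨w', h', hw', rfl⟩ := hy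
      rw [← diagram_append, ← diagram_append, annularTraceₗ_diagram, annularTraceₗ_diagram,
        annularBracket_rotate (by rw [width_append, hw, hw']), hw]
    | zero => simp
    | add y y' _ _ h h' => rw [mul_add, add_mul, map_add, map_add, h, h']
    | smul r y _ h => rw [mul_smul_comm, smul_mul_assoc, map_smul, map_smul, h]
  | zero => simp
  | add x x' _ _ h h' => rw [mul_add, add_mul, map_add, map_add, h, h']
  | smul r x _ h => rw [mul_smul_comm, smul_mul_assoc, map_smul, map_smul, h]

theorem annularTraceₗ_succ {n : ℕ} {x : Tangles} (hx : x ∈ closedSpan n) :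
    annularTraceₗ (n + 1) x = X * annularTraceₗ n x := by
  induction hx using Submodule.span_induction with
  | mem x hx =>
    obtain ⟨w, h, hw, rfl⟩ := hx
    rw [annularTraceₗ_diagram, annularTraceₗ_diagram, annularBracket_succ h hw]
  | zero => simp
  | add x y _ _ h h' => rw [map_add, map_add, h, h', mul_add]
  | smul r x _ h => rw [map_smul, map_smul, h, mul_smul_comm]

theorem annularTraceₗ_mul_e {k : ℕ} {x : Tangles} (hx : x ∈ closedSpan k) :
    annularTraceₗ (k + 2) (x * e k) = C d * annularTraceₗ k x := by
  induction hx using Submodule.span_induction with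
  | mem x hx =>
    obtain ⟨w, h, hw, rfl⟩ := hx
    rw [e, ← diagram_append, annularTraceₗ_diagram, annularTraceₗ_diagram,
      annularBracket_cap_cup h hw]
  | zero => simp
  | add x y _ _ h h' => rw [add_mul, map_add, map_add, h, h', mul_add]
  | smul r x _ h => rw [smul_mul_assoc, map_smul, map_smul, h, mul_smul_comm]

theorem annularTraceₗ_mul_e_mul_e {k : ℕ} {x : Tangles} (hx : x ∈ closedSpan (k + 1)) :
    annularTraceₗ (k + 3) (x * e k * e (k + 1)) = annularTraceₗ (k + 1) x := by
  induction hx using Submodule.span_induction with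
  | mem x hx =>
    obtain ⟨w, h, hw, rfl⟩ := hx
    rw [mul_assoc, e_mul_e, ← diagram_append, annularTraceₗ_diagram, annularTraceₗ_diagram,
      annularBracket_cap_cup_cap_cup h hw]
  | zero => simp
  | add x y _ _ h h' => rw [add_mul, add_mul, map_add, map_add, h, h']
  | smul r x _ h => rw [smul_mul_assoc, smul_mul_assoc, map_smul, map_smul, h]

/-! ### The trace of the symmetrizer -/

theorem symmetrizer_mul_cosetSum_smodEq {N n j : ℕ} (hn : n ≤ N) (hj : j + 1 ≤ n) (z : Tangles) :
    symmetrizer e n * cosetSum e j * z ≡ (quantumInt (j + 1) • symmetrizer e n) * z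
      [SMOD relations N] :=
  ((Implements.symmetrizer hn).mul (Implements.cosetSum (hj.trans hn))).smodEq
    ((Implements.symmetrizer hn).smul _) (mul_cosetSum_of_forall
      (fun _ hi => (isTemperleyLieb_eAct N).symmetrizer_mul hi hn) hj) z

theorem cosetSum_mul_symmetrizer_smodEq {N n j : ℕ} (hn : n ≤ N) (hj : j + 1 ≤ n) (z : Tangles) :
    cosetSum e j * symmetrizer e n * z ≡ (quantumInt (j + 1) • symmetrizer e n) * z
      [SMOD relations N] :=
  ((Implements.cosetSum (hj.trans hn)).mul (Implements.symmetrizer hn)).smodEq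
    ((Implements.symmetrizer hn).smul _) (cosetSum_mul_of_forall
      (fun _ hi => (isTemperleyLieb_eAct N).mul_symmetrizer hi hn) hj) z

theorem annularTraceₗ_symmetrizer_mul_cosetSum {N n j : ℕ} (hn : n ≤ N) (hj : j + 1 ≤ n)
    (z : Tangles) : annularTraceₗ N (symmetrizer e n * cosetSum e j * z) =
      C (quantumInt (j + 1)) * annularTraceₗ N (symmetrizer e n * z) := by
  rw [annularTraceₗ_eq_of_smodEq (symmetrizer_mul_cosetSum_smodEq hn hj z), smul_mul_assoc, map_smul,
    smul_eq_C_mul]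

/-- The trace property brings the coset sum around to the symmetrizer, which absorbs it. -/
theorem annularTraceₗ_symmetrizer_mul_mul_cosetSum {N n j : ℕ} (hn : n ≤ N) (hj : j + 1 ≤ n)
    {z : Tangles} (hz : z ∈ closedSpan N) :
    annularTraceₗ N (symmetrizer e n * z * cosetSum e j) =
      C (quantumInt (j + 1)) * annularTraceₗ N (symmetrizer e n * z) := by
  rw [annularTraceₗ_mul_comm (mul_mem_closedSpan (symmetrizer_mem hn) hz)
      (cosetSum_mem (hj.trans hn)), ← mul_assoc,
    annularTraceₗ_eq_of_smodEq (cosetSum_mul_symmetrizer_smodEq hn hj z), smul_mul_assoc, map_smul,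
    smul_eq_C_mul]

theorem symmetrizer_succ_succ (k : ℕ) (z : Tangles) :
    symmetrizer e (k + 2) * z = symmetrizer e (k + 1) * z +
      (A ^ 4 • (symmetrizer e (k + 1) * cosetSum e k * z) +
        A ^ 2 • (symmetrizer e (k + 1) * e k * cosetSum e k * z)) := by
  have h : symmetrizer e (k + 2) = symmetrizer e (k + 1) * (1 + crossing e k * cosetSum e k) := rfl
  rw [h, crossing]
  simp only [mul_add, add_mul, mul_smul_comm, smul_mul_assoc, mul_one, one_mul, mul_assoc]

/-- The factor `e k` closes the last strand of the symmetrizer trivially. In the expansion of its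
last coset sum, the terms without `e (k - 1)` contribute `d (1 + A⁴ [k]) = d [k + 1]`, and the term
with it contributes `A² [k]`. -/
theorem annularTraceₗ_symmetrizer_mul_e (k : ℕ) :
    annularTraceₗ (k + 2) (symmetrizer e (k + 1) * e k) =
      C (d * quantumInt (k + 1) + A ^ 2 * quantumInt k) * annularTraceₗ k (symmetrizer e k) := by
  cases k with
  | zero =>
    have h : symmetrizer e (0 + 1) = symmetrizer e 0 := mul_one _
    rw [h, annularTraceₗ_mul_e (symmetrizer_mem le_rfl),
      quantumInt_one, quantumInt_zero, mul_one, mul_zero, add_zero]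
  | succ l =>
    have hF : symmetrizer e (l + 1) ∈ closedSpan (l + 1) := symmetrizer_mem le_rfl
    have h1 := annularTraceₗ_symmetrizer_mul_cosetSum (N := l + 3) (n := l + 1) (j := l) (by omega)
      le_rfl (e (l + 1))
    -- The coset sum on the first `l + 1` strands commutes with `e (l + 1)`, so it can be moved to
    -- the end and then absorbed under the trace.
    have h2 : annularTraceₗ (l + 3) (symmetrizer e (l + 1) * e l * cosetSum e l * e (l + 1)) =
        annularTraceₗ (l + 3) (symmetrizer e (l + 1) * (e l * e (l + 1)) * cosetSum e l) := by
      have hS := Implements.symmetrizer (N := l + 3) (n := l + 1) (by omega)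
      have hc := Implements.cosetSum (N := l + 3) (n := l) (by omega)
      have he := implements_eAct (N := l + 3) (i := l) (by omega)
      have he' := implements_eAct (N := l + 3) (i := l + 1) le_rfl
      have := (((hS.mul he).mul hc).mul he').smodEq ((hS.mul (he.mul he')).mul hc) (by
        rw [mul_assoc, ((isTemperleyLieb_eAct (l + 3)).cosetSum_commute le_rfl le_rfl).eq]
        simp only [mul_assoc]) 1
      rw [mul_one, mul_one] at this
      exact annularTraceₗ_eq_of_smodEq this
    have h3 := annularTraceₗ_symmetrizer_mul_mul_cosetSum (N := l + 3) (n := l + 1) (j := l)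
      (by omega) le_rfl (mul_mem_closedSpan (e_mem_closedSpan (N := l + 3) (i := l) (by omega))
        (e_mem_closedSpan (N := l + 3) (i := l + 1) le_rfl))
    rw [← mul_assoc (symmetrizer e (l + 1)) (e l) (e (l + 1)),
      annularTraceₗ_mul_e_mul_e hF] at h3
    have h4 := annularTraceₗ_mul_e hF
    rw [symmetrizer_succ_succ, map_add, map_add, map_smul, map_smul, h1, h2, h4,
      ← mul_assoc (symmetrizer e (l + 1)) (e l) (e (l + 1)), h3,
      smul_eq_C_mul, smul_eq_C_mul, quantumInt_succ (l + 1)]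
    simp only [C_add, C_mul, C_1]
    ring

/-- Expand the last coset sum. Where the last strand runs straight it contributes `ζ`, with
coefficient `1 + A⁴ [k + 1] = [k + 2]`; the term with `e k` closes it trivially and has coefficient
`-[k + 1] [k + 2]`. -/
theorem annularTraceₗ_symmetrizer_succ_succ (k : ℕ) :
    annularTraceₗ (k + 2) (symmetrizer e (k + 2)) =
      C (quantumInt (k + 2)) * (X * annularTraceₗ (k + 1) (symmetrizer e (k + 1)) -
        C (quantumInt (k + 1)) * annularTraceₗ k (symmetrizer e k)) := by
  have h1 := annularTraceₗ_symmetrizer_mul_cosetSum (N := k + 2) (n := k + 1) (j := k) (by omega)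
    le_rfl 1
  have h2 := annularTraceₗ_symmetrizer_mul_mul_cosetSum (N := k + 2) (n := k + 1) (j := k)
    (by omega) le_rfl (e_mem_closedSpan (N := k + 2) (i := k) le_rfl)
  have h3 := annularTraceₗ_succ (symmetrizer_mem (n := k + 1) le_rfl)
  have h4 := congrArg (C : K → K[X]) (A_sq_mul_d_mul_quantumInt k)
  have h5 := congrArg (C : K → K[X]) (quantumInt_succ (k + 1))
  have h6 := symmetrizer_succ_succ k 1
  simp only [mul_one] at h1 h6
  rw [h6, map_add, map_add, map_smul, map_smul, h1, h2, annularTraceₗ_symmetrizer_mul_e,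
    smul_eq_C_mul, smul_eq_C_mul, h3]
  simp only [C_add, C_mul, C_neg, C_1] at h4 h5 ⊢
  linear_combination C (quantumInt (k + 1)) * annularTraceₗ k (symmetrizer e k) * h4 -
    X * annularTraceₗ (k + 1) (symmetrizer e (k + 1)) * h5

theorem annularTraceₗ_symmetrizer (n : ℕ) :
    annularTraceₗ n (symmetrizer e n) = C (quantumFactorial n) * Chebyshev.S K (n : ℤ) := by
  induction n using Nat.twoStepInduction with
  | zero =>
    rw [symmetrizer, ← diagram_nil, annularTraceₗ_diagram, annularBracket_nil,
      quantumFactorial_zero]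
    simp
  | one =>
    rw [symmetrizer, cosetSum, mul_one, symmetrizer, ← diagram_nil, annularTraceₗ_diagram,
      annularBracket_nil, quantumFactorial_succ, quantumFactorial_zero, quantumInt_one]
    simp
  | more k ih0 ih1 =>
    rw [annularTraceₗ_symmetrizer_succ_succ, ih0, ih1, quantumFactorial_succ (k + 1),
      quantumFactorial_succ k]
    push_cast
    rw [Chebyshev.S_add_two]
    simp only [C_mul]
    ring

/-- The closure of the Jones-Wenzl idempotent around the annulus is a Chebyshev polynomial. -/
theorem annularTrace_jonesWenzl (n : ℕ) :
    annularTrace n (jonesWenzl 0 n) = Chebyshev.S K (n : ℤ) := by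
  have h : (fun i => e (0 + i)) = e := by simp
  rw [jonesWenzl_eq, h, ← annularTraceₗ_apply, map_smul, annularTraceₗ_symmetrizer, smul_eq_C_mul,
    ← mul_assoc, ← C_mul, inv_mul_cancel₀ (quantumFactorial_ne_zero n), C_1, one_mul]

/-! ### The values in the plane -/

theorem Delta_zero : Delta 0 = 1 := by
  rw [Delta, pow_zero, one_mul]
  exact div_self (A_pow_sub_ne_zero two_ne_zero)

theorem Delta_one : Delta 1 = d := by
  have h := A_pow_sub_ne_zero two_ne_zero
  rw [Delta, div_eq_iff h, d]
  have := A_ne_zero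
  field_simp
  ring

theorem Delta_add_two (n : ℕ) : Delta (n + 2) = d * Delta (n + 1) - Delta n := by
  have h := A_pow_sub_ne_zero two_ne_zero
  have hA := A_ne_zero
  rw [Delta, Delta, Delta, div_eq_iff h, sub_mul, mul_assoc, div_mul_cancel₀ _ h,
    div_mul_cancel₀ _ h, d]
  have e1 : A ^ (2 * (n + 2) + 2) = A ^ (2 * n + 2) * A ^ 4 := by ring
  have e2 : A ^ (2 * (n + 1) + 2) = A ^ (2 * n + 2) * A ^ 2 := by ring
  have hB : A ^ (2 * n + 2) ≠ 0 := pow_ne_zero _ hA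
  rw [e1, e2]
  generalize A ^ (2 * n + 2) = B at hB
  rw [pow_add, pow_add, pow_one]
  field_simp
  ring

theorem eval_chebyshev_S (n : ℕ) : (Chebyshev.S K (n : ℤ)).eval d = Delta n := by
  induction n using Nat.twoStepInduction with
  | zero => simp [Delta_zero]
  | one => simp [Delta_one]
  | more n ih0 ih1 =>
    push_cast at ih1 ⊢
    rw [Chebyshev.S_add_two, eval_sub, eval_mul, eval_X, ih0, ih1, Delta_add_two]

theorem Delta_ne_zero (n : ℕ) : Delta n ≠ 0 :=
  div_ne_zero (mul_ne_zero (pow_ne_zero _ (neg_ne_zero.2 one_ne_zero))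
    (A_pow_sub_ne_zero (by omega))) (A_pow_sub_ne_zero two_ne_zero)

/-! ### The theta curve -/

/-- Closed stacks absorbed by the symmetrizer become multiples of it. -/
theorem exists_symmetrizer_mul_smodEq {N : ℕ} {x : Tangles} (hx : x ∈ closedSpan N) :
    ∃ c : K, symmetrizer e N * x ≡ c • symmetrizer e N [SMOD relations N] := by
  have hS := Implements.symmetrizer (le_refl N)
  induction hx using Submodule.span_induction with
  | mem x hx =>
    obtain ⟨w, h, hw, rfl⟩ := hx
    obtain ⟨c, ps, us, hv, hw', hc⟩ := h.exists_smodEq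
    rw [hw] at hw'
    cases ps with
    | nil =>
      have hus : us = [] := by
        rw [List.map_nil, List.nil_append, width_cups] at hw'
        exact List.length_eq_zero_iff.1 (by omega)
      subst hus
      refine ⟨c, ?_⟩
      have hc : Submodule.Quotient.mk (p := relations N) (diagram w) =
        Submodule.Quotient.mk (c • diagram []) := hc
      rw [SModEq, ← hS, hc, hS, diagram_nil, mul_smul_comm, mul_one]
    | cons i ps =>
      -- A stack `y` that begins with the cap `i` satisfies `e i * y ≡ d • y`. The symmetrizer kills
      -- `e i`, and `d ≠ 0`, so it kills `y`.
      refine ⟨0, ?_⟩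
      have hi : i + 2 ≤ N := hv.1
      set y := diagram ((i :: ps).map Slice.cap ++ us.map Slice.cup) with hy
      have h1 : e i * y ≡ d • y [SMOD relations N] := by
        rw [hy, e_mul_diagram]
        exact (LocalRel.circle i (m := N - 2) (by omega)).smodEq' (u := [.cap i]) rfl _
      have h1 : Submodule.Quotient.mk (p := relations N) (e i * y) =
        Submodule.Quotient.mk (d • y) := h1
      have h2 : d • symmetrizer (eAct N) N (Submodule.Quotient.mk y) = 0 := by
        rw [← map_smul, ← Submodule.Quotient.mk_smul, ← h1, ← implements_eAct hi,
          ← Module.End.mul_apply, (isTemperleyLieb_eAct N).symmetrizer_mul hi le_rfl]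
        rfl
      have hc : Submodule.Quotient.mk (p := relations N) (diagram w) =
        Submodule.Quotient.mk (c • y) := hc
      rw [SModEq, ← hS, hc, Submodule.Quotient.mk_smul, map_smul,
        (smul_eq_zero.1 h2).resolve_left d_ne_zero, smul_zero, zero_smul,
        Submodule.Quotient.mk_zero]
  | zero => exact ⟨0, by rw [mul_zero, zero_smul]⟩
  | add x y _ _ hx hy =>
    obtain ⟨a, ha⟩ := hx
    obtain ⟨b, hb⟩ := hy
    exact ⟨a + b, by rw [mul_add, add_smul]; exact ha.add hb⟩
  | smul r x _ hx =>
    obtain ⟨a, ha⟩ := hx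
    exact ⟨r * a, by rw [mul_smul_comm, mul_smul]; exact ha.smul r⟩

theorem valid_cups (x y z : ℕ) :
    Valid (x + y) ((List.range z).map fun k => Slice.cup (y + k)) ∧
      width (x + y) ((List.range z).map fun k => Slice.cup (y + k)) = x + y + 2 * z := by
  induction z with
  | zero => exact ⟨trivial, rfl⟩
  | succ z ih =>
    rw [List.range_succ, List.map_append, valid_append, width_append, ih.2]
    refine ⟨⟨ih.1, valid_singleton.2 ?_⟩, ?_⟩
    · simp only [Slice.Fits]
      omega
    · simp only [List.map_cons, List.map_nil, width_cons, width_nil, Slice.below]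
      omega

theorem valid_caps (x y z : ℕ) :
    Valid (x + y + 2 * z) ((List.range z).reverse.map fun k => Slice.cap (y + k)) ∧
      width (x + y + 2 * z) ((List.range z).reverse.map fun k => Slice.cap (y + k)) = x + y := by
  induction z with
  | zero => exact ⟨trivial, rfl⟩
  | succ z ih =>
    rw [List.range_succ, List.reverse_append, List.reverse_singleton, List.singleton_append,
      List.map_cons, width_cons]
    have hb : (Slice.cap (y + z)).below (x + y + 2 * (z + 1)) = x + y + 2 * z := by
      simp only [Slice.below]
      omega
    refine ⟨⟨?_, ?_⟩, ?_⟩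
    · simp only [Slice.Fits]
      omega
    · rw [hb]
      exact ih.1
    · rw [hb]
      exact ih.2

/-- Of the idempotents on `a` and `b` it only matters that they are combinations of stacks that fit
on the strands present. -/
theorem openTheta_eq (x y z : ℕ) :
    ∃ t ∈ closedSpan (x + y), openTheta x y z = jonesWenzl 0 (x + y) * t := by
  refine ⟨nestedCups y z * (jonesWenzl 0 (y + z) * jonesWenzl (y + z) (x + z)) * nestedCaps y z,
    ?_, ?_⟩
  · refine mul_mem_of_closedSpan (valid_cups x y z).1 (valid_cups x y z).2 (valid_caps x y z).1
      (valid_caps x y z).2 (mul_mem_closedSpan ?_ ?_)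
    · rw [jonesWenzl_eq]
      exact Submodule.smul_mem _ _ (symmetrizer_mem_closedSpan (by omega))
    · rw [jonesWenzl_eq]
      exact Submodule.smul_mem _ _ (symmetrizer_mem_closedSpan (by omega))
  · rw [openTheta]
    simp only [mul_assoc]

theorem exists_annularTheta_eq (x y z : ℕ) :
    ∃ c : K, annularTheta x y z = C c * Chebyshev.S K ((x + y : ℕ) : ℤ) := by
  obtain ⟨t, ht, hθ⟩ := openTheta_eq x y z
  obtain ⟨c, hc⟩ := exists_symmetrizer_mul_smodEq ht
  refine ⟨c, ?_⟩
  have h : (fun i => e (0 + i)) = e := by simp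
  have hJ := annularTrace_jonesWenzl (x + y)
  rw [annularTheta, hθ, ← annularTraceₗ_apply]
  rw [jonesWenzl_eq, h, ← annularTraceₗ_apply, map_smul] at hJ
  rw [jonesWenzl_eq, h, smul_mul_assoc, map_smul, annularTraceₗ_eq_of_smodEq hc, map_smul,
    smul_comm, hJ, smul_eq_C_mul]

end

end ThetaNet

/-! ### The evaluation of the theta curve -/

theorem mainTheorem3 (x y z : ℕ) :
    ThetaNet.annularTheta x y z =
        Polynomial.C (ThetaNet.planarTheta x y z / ThetaNet.Delta (x + y)) *
          Polynomial.Chebyshev.S ThetaNet.K ((x + y : ℕ) : ℤ) ∧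
      ThetaNet.annularTrace (x + y) (ThetaNet.jonesWenzl 0 (x + y)) =
        Polynomial.Chebyshev.S ThetaNet.K ((x + y : ℕ) : ℤ) ∧
      ThetaNet.planarTrace (x + y) (ThetaNet.jonesWenzl 0 (x + y)) = ThetaNet.Delta (x + y) ∧
      ThetaNet.Delta (x + y) ≠ 0 := by
  have hJ := ThetaNet.annularTrace_jonesWenzl (x + y)
  refine ⟨?_, hJ, ?_, ThetaNet.Delta_ne_zero _⟩
  · obtain ⟨c, hc⟩ := ThetaNet.exists_annularTheta_eq x y z
    -- The scalar is read off in the plane by evaluating the annular identity at `ζ = d`.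
    have hp : ThetaNet.planarTheta x y z = c * ThetaNet.Delta (x + y) := by
      rw [ThetaNet.planarTheta, ThetaNet.planarTrace_eq_eval, ← ThetaNet.annularTheta, hc,
        Polynomial.eval_mul, Polynomial.eval_C, ThetaNet.eval_chebyshev_S]
    rw [hp, mul_div_cancel_right₀ _ (ThetaNet.Delta_ne_zero _), hc]
  · rw [ThetaNet.planarTrace_eq_eval, hJ, ThetaNet.eval_chebyshev_S]
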